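/- Definitions. All algebras are unital and associative over a ground field $\mathbf{k}$ of characteristic $0$. A *modified differential algebra* is an algebra $R$ with a $\mathbf{k}$-linear $D:R\to R$ such that $D(xy)=D(x)y+xD(y)-xD(1)y$. It is a *modified differential Reynolds algebra* if moreover there is a $\mathbf{k}$-linear $P:R\to R$ with $DP=\mathrm{id}_R$ and $P(x)P(y)=P(P(x)y)+P(xP(y))-P(P(x)D(1)P(y))$. Let $(A,d)$ be a commutative modified differential algebra. A *compatible complete modified differential Reynolds algebra over $(A,d)$* is a tuple $(R,R_n,D,P)$ in which $(R,D,P)$ is a modified differential Reynolds algebra, $R$ is an $A$-algebra whose structure map $i_R:A\to R$ satisfies $i_Rd=Di_R$, and $R=R_0\supseteq R_1\supseteq\cdots$ are $A$-submodules stable under $P$ such that $R\to\varprojlim R/R_n$ is an isomorphism and $R_n$ is, for every $n\ge 1$, the closure (in the topology given by the filtration) of the $A$-submodule generated by $P(R_{n-1})$. A morphism is a homomorphism of $A$-algebras that commutes with $D$ and with $P$ and maps the $n$-th filtration step into the $n$-th filtration step. A *free commutative* one is an initial object among those with $R$ commutative. The algebra $\mathrm{Sh}(A)$ of $(A,d)$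 is $\prod_{j\ge1}A^{\otimes j}$ (tensor powers over $\mathbf{k}$), with filtration $\mathrm{Sh}(A)_n=\prod_{j\ge n+1}A^{\otimes j}$, inclusion of $A$ as $A^{\otimes 1}$, operators $P(\mathfrak a)=1\otimes\mathfrak a$, $D(a_0)=d(a_0)$ and $D(a_0\otimes\cdots\otimes a_j)=d(a_0)\otimes a_1\otimes\cdots\otimes a_j+a_0a_1\otimes a_2\otimes\cdots\otimes a_j-d(1)a_0\otimes a_1\otimes\cdots\otimes a_j$ for $j\ge1$, and product $(a_0\otimes\mathfrak a')(b_0\otimes\mathfrak b')=a_0b_0\otimes(\mathfrak a'\,\diamond\,\mathfrak b')$, extended to series. Here the complete shuffle product $\mathfrak a\,\diamond\,\mathfrak b$ of $\mathfrak a=a_1\otimes\cdots\otimes a_p$ and $\mathfrak b=b_1\otimes\cdots\otimes b_q$ is the sum of all tensors obtained from the shuffles of $\mathfrak a$ and $\mathfrak b$ by inserting any numbers of factors $-d(1)$ at places that precede both $a_p$ and $b_q$ (for $p=0$ or $q=0$ nothing is inserted, and $1$ is neutral). Proposition. Let $k\in\mathbb{R}[[x]]$ have nonzero constant term $k(0)$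 and nonzero coefficient of $x$, let $\mu\in\mathbb{R}$, $\mu\ne0$, and let $h=\mu\,(1/k)'$. Then $h$ has nonzero constant term. For $f\in\mathbb{R}[[x]]$ put $$D_K(f)=\frac1h\Big(\frac fk\Big)',\qquad P_K(f)=k(x)\int_0^xh(t)f(t)\,dt$$ (termwise differentiation and integration). Then, with $\mathbf{k}=\mathbb{R}$: 1. $(\mathbb{R}[[x]],x^n\mathbb{R}[[x]],D_K,P_K)$ is a compatible complete modified differential Reynolds algebra over $(\mathbb{R},\mu^{-1}\mathrm{id})$. 2. It is a free commutative compatible complete modified differential Reynolds algebra over $(\mathbb{R},\mu^{-1}\mathrm{id})$. 3. There is an isomorphism from $\mathrm{Sh}(\mathbb{R})$, formed from $(\mathbb{R},\mu^{-1}\mathrm{id})$, onto $\mathbb{R}[[x]]$ (linear, bijective, respecting the products, the inclusions of $\mathbb{R}$, $D$, $P$ and the filtrations), and it sends $1^{\otimes(n+1)}$ to $P_K^n(1)$ for all $n\ge0$. 4. For all $n\ge0$, $$P_K^n(1)=\mu^n\,\frac{k(x)}{k(0)}\sum_{s\ge n}\frac{\ln^s(k(0)/k(x))}{s!},$$ where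 $\ln u=\sum_{j\ge1}(-1)^{j+1}(u-1)^j/j$ and the sum converges $x$-adically. -/

import Mathlib

open scoped TensorProduct PowerSeries

universe u

noncomputable section

/-! ### Modified differential algebras and modified differential Reynolds algebras -/

/-- `D` is a modified differential operator on `R` (of weight `D 1`), over the ground field `𝕜`. -/
def IsModifiedDifferential {𝕜 R : Type*} [Field 𝕜] [Ring R] [Module 𝕜 R]
    (D : R →ₗ[𝕜] R) : Prop :=
  ∀ x y : R, D (x * y) = D x * y + x * D y - x * D 1 * y

/-- `(R, D, P)` is a modified differential Reynolds algebra: `D` is a modified differential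
operator, `P` is a Reynolds operator of weight `D 1`, and `D ∘ P = id`. -/
structure IsModifiedDifferentialReynolds {𝕜 R : Type*} [Field 𝕜] [Ring R] [Module 𝕜 R]
    (D P : R →ₗ[𝕜] R) : Prop where
  differential : IsModifiedDifferential D
  reynolds : ∀ x y : R, P x * P y = P (P x * y) + P (x * P y) - P (P x * D 1 * P y)
  section_eq : ∀ x : R, D (P x) = x

/-! ### Complete filtered modules -/

/-- The inverse limit of the quotients `R / F n` of a decreasingly filtered module. -/
def filtrationLimit {A R : Type*} [CommRing A] [AddCommGroup R] [Module A R]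
    (F : ℕ → Submodule A R) (hF : Antitone F) : Submodule A (∀ n, R ⧸ F n) where
  carrier := {s | ∀ m n (hmn : m ≤ n), Submodule.factor (hF hmn) (s n) = s m}
  add_mem' := by
    intro s t hs ht m n hmn
    simp only [Pi.add_apply, map_add, hs m n hmn, ht m n hmn]
  zero_mem' := by
    intro m n hmn
    simp only [Pi.zero_apply, map_zero]
  smul_mem' := by
    intro c s hs m n hmn
    simp only [Pi.smul_apply, map_smul, hs m n hmn]

/-- The natural map from `R` to the inverse limit of the `R / F n`. -/
def filtrationLimitMap {A R : Type*} [CommRing A] [AddCommGroup R] [Module A R]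
    (F : ℕ → Submodule A R) (hF : Antitone F) : R →ₗ[A] filtrationLimit F hF :=
  LinearMap.codRestrict _ (LinearMap.pi fun n => (F n).mkQ) (by
    intro x m n hmn
    exact Submodule.factor_mk (hF hmn) x)

/-- `(R, F)` is a complete `A`-module: `F` is a decreasing filtration by submodules and the natural
map to the inverse limit is an isomorphism. -/
def IsCompleteFiltration {A R : Type*} [CommRing A] [AddCommGroup R] [Module A R]
    (F : ℕ → Submodule A R) : Prop :=
  ∃ hF : Antitone F, Function.Bijective (filtrationLimitMap F hF)

/-- The topology given by a decreasing filtration: it is generated by the cosets `x + F n`. -/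
@[reducible] def filtrationTopology {A R : Type*} [CommRing A] [AddCommGroup R] [Module A R]
    (F : ℕ → Submodule A R) : TopologicalSpace R :=
  TopologicalSpace.generateFrom {U | ∃ (x : R) (n : ℕ), U = {y | y - x ∈ F n}}

/-- The operator generated filtration: it starts with `R`, and the next step is the closure of the
`A`-submodule generated by the image under `P` of the previous step. -/
def operatorFiltration {𝕜 A R : Type*} [Field 𝕜] [CommRing A] [AddCommGroup R] [Module 𝕜 R]
    [Module A R] (F : ℕ → Submodule A R) (P : R →ₗ[𝕜] R) : ℕ → Set R
  | 0 => Set.univ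
  | n + 1 => @closure R (filtrationTopology F)
      (Submodule.span A (P '' operatorFiltration F P n) : Set R)

/-- `(R, F, P)` is a compatible complete operated `A`-module. -/
structure IsCompatibleComplete {𝕜 A R : Type*} [Field 𝕜] [CommRing A] [AddCommGroup R]
    [Module 𝕜 R] [Module A R] (F : ℕ → Submodule A R) (P : R →ₗ[𝕜] R) : Prop where
  complete : IsCompleteFiltration F
  operated : ∀ n, ∀ x ∈ F n, P x ∈ F n
  compatible : ∀ n, (F n : Set R) = operatorFiltration F P n

/-! ### Compatible complete modified differential Reynolds algebras and the free ones -/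

/-- `(R, F, D, P)`, with the structure map `algebraMap A R`, is a compatible complete modified
differential Reynolds algebra over the commutative modified differential algebra `(A, d)`. -/
structure IsCCMDRA {𝕜 A R : Type*} [Field 𝕜] [CommRing A] [Algebra 𝕜 A] [Ring R] [Algebra A R]
    [Algebra 𝕜 R] [IsScalarTower 𝕜 A R] (d : A →ₗ[𝕜] A)
    (F : ℕ → Submodule A R) (D P : R →ₗ[𝕜] R) : Prop where
  base : IsModifiedDifferential d
  map_base : ∀ a : A, algebraMap A R (d a) = D (algebraMap A R a)
  compatibleComplete : IsCompatibleComplete F P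
  reynolds : IsModifiedDifferentialReynolds D P

/-- Morphisms of compatible complete modified differential Reynolds algebras over `(A, d)`:
homomorphisms of `A`-algebras that commute with the operators and preserve the filtrations. -/
structure IsCCMDRAHom {𝕜 A R S : Type*} [Field 𝕜] [CommRing A] [Ring R] [Algebra A R]
    [Module 𝕜 R] [Ring S] [Algebra A S] [Module 𝕜 S]
    (F : ℕ → Submodule A R) (D P : R →ₗ[𝕜] R) (F' : ℕ → Submodule A S) (D' P' : S →ₗ[𝕜] S)
    (f : R →ₐ[A] S) : Prop where
  map_D : ∀ x, f (D x) = D' (f x)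
  map_P : ∀ x, f (P x) = P' (f x)
  map_filtration : ∀ n, ∀ x ∈ F n, f x ∈ F' n

/-- `(R, F, D, P)` is a free commutative compatible complete modified differential Reynolds algebra
over `(A, d)`: an initial object among the commutative ones (with carrier in universe `v`). -/
def IsFreeCCMDRA.{v, u₁, u₂, u₃} {𝕜 : Type u₁} {A : Type u₂} {R : Type u₃} [Field 𝕜] [CommRing A]
    [Algebra 𝕜 A] [CommRing R] [Algebra A R] [Algebra 𝕜 R] [IsScalarTower 𝕜 A R]
    (d : A →ₗ[𝕜] A) (F : ℕ → Submodule A R) (D P : R →ₗ[𝕜] R) : Prop :=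
  IsCCMDRA d F D P ∧
    ∀ (S : Type v) [CommRing S] [Algebra A S] [Algebra 𝕜 S] [IsScalarTower 𝕜 A S]
      (F' : ℕ → Submodule A S) (D' P' : S →ₗ[𝕜] S), IsCCMDRA d F' D' P' →
        ∃! f : R →ₐ[A] S, IsCCMDRAHom F D P F' D' P' f

/-! ### The complete shuffle product

For `a = a₁ ⊗ ⋯ ⊗ aₘ` and `b = b₁ ⊗ ⋯ ⊗ bₙ`, an extended shuffle of length `r` is recorded by the
positions `p` of the factors of `a` and `q` of the factors of `b` in the word of length `r`; all
other positions hold a copy of `-λ`, and they are allowed only before the last factor of `a` and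
also before the last factor of `b`. -/

/-- The extended shuffles of length `r` of a word of length `m` and a word of length `n`. -/
structure IsExtendedShuffle {m n r : ℕ} (p : Fin m → Fin r) (q : Fin n → Fin r) : Prop where
  left : StrictMono p
  right : StrictMono q
  disjoint : ∀ i j, p i ≠ q j
  inserted : ∀ l, (∀ i, p i ≠ l) → (∀ j, q j ≠ l) → (∃ i, l < p i) ∧ (∃ j, l < q j)

open Classical in
/-- The word with letters `a i` at `p i`, `b j` at `q j`, and `c` elsewhere. -/
def shuffleWord {A : Type*} {m n r : ℕ} (p : Fin m → Fin r) (q : Fin n → Fin r) (c : A)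
    (a : Fin m → A) (b : Fin n → A) (l : Fin r) : A :=
  if h : ∃ i, p i = l then a h.choose
  else if h : ∃ j, q j = l then b h.choose
  else c

theorem shuffleWord_update_left {A : Type*} {m n r : ℕ} {p : Fin m → Fin r} {q : Fin n → Fin r}
    (h : IsExtendedShuffle p q) (c : A) [DecidableEq (Fin m)] (a : Fin m → A) (b : Fin n → A)
    (i : Fin m) (x : A) :
    shuffleWord p q c (Function.update a i x) b
      = Function.update (shuffleWord p q c a b) (p i) x := by
  funext l
  by_cases hl : l = p i
  · subst hl
    have h1 : ∃ i', p i' = p i := ⟨i, rfl⟩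
    have h2 : h1.choose = i := h.left.injective h1.choose_spec
    simp [shuffleWord, h1, h2]
  · rw [Function.update_of_ne hl]
    unfold shuffleWord
    split_ifs with h1
    · have : h1.choose ≠ i := fun e => hl (by rw [← h1.choose_spec, e])
      rw [Function.update_of_ne this]
    · rfl
    · rfl

theorem shuffleWord_update_right {A : Type*} {m n r : ℕ} {p : Fin m → Fin r} {q : Fin n → Fin r}
    (h : IsExtendedShuffle p q) (c : A) [DecidableEq (Fin n)] (a : Fin m → A) (b : Fin n → A)
    (j : Fin n) (x : A) :
    shuffleWord p q c a (Function.update b j x)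
      = Function.update (shuffleWord p q c a b) (q j) x := by
  funext l
  by_cases hl : l = q j
  · subst hl
    have h0 : ¬ ∃ i, p i = q j := fun ⟨i, hi⟩ => h.disjoint i j hi
    have h1 : ∃ j', q j' = q j := ⟨j, rfl⟩
    have h2 : h1.choose = j := h.right.injective h1.choose_spec
    simp only [shuffleWord, dif_neg h0, dif_pos h1, h2, Function.update_self]
  · rw [Function.update_of_ne hl]
    unfold shuffleWord
    split_ifs with h0 h1
    · rfl
    · have : h1.choose ≠ j := fun e => hl (by rw [← h1.choose_spec, e])
      rw [Function.update_of_ne this]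
    · rfl

section Shuffle

variable (𝕜 : Type*) {A : Type*} [Field 𝕜] [CommRing A] [Algebra 𝕜 A]

/-- The tensor of a given extended shuffle, as a multilinear map in both words. -/
def shuffleTensor {m n r : ℕ} {p : Fin m → Fin r} {q : Fin n → Fin r}
    (h : IsExtendedShuffle p q) (c : A) :
    MultilinearMap 𝕜 (fun _ : Fin m => A)
      (MultilinearMap 𝕜 (fun _ : Fin n => A) (⨂[𝕜]^r A)) where
  toFun a :=
    { toFun := fun b => PiTensorProduct.tprod 𝕜 (shuffleWord p q c a b)
      map_update_add' := by
        intro _ b j x y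
        simp only [shuffleWord_update_right h, MultilinearMap.map_update_add]
      map_update_smul' := by
        intro _ b j t x
        simp only [shuffleWord_update_right h, MultilinearMap.map_update_smul] }
  map_update_add' := by
    intro _ a i x y
    ext b
    simp only [MultilinearMap.coe_mk, add_apply, shuffleWord_update_left h,
      MultilinearMap.map_update_add]
  map_update_smul' := by
    intro _ a i t x
    ext b
    simp only [MultilinearMap.coe_mk, smul_apply, shuffleWord_update_left h,
      MultilinearMap.map_update_smul]

open Classical in
/-- The component of tensor degree `r` of the complete shuffle product (for the weight `c`) of
tensors of degrees `m` and `n`: the sum of all the extended shuffles of length `r`, with `-c`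
inserted. -/
def completeShuffle (c : A) (m n r : ℕ) : (⨂[𝕜]^m A) →ₗ[𝕜] (⨂[𝕜]^n A) →ₗ[𝕜] (⨂[𝕜]^r A) :=
  ∑ s : {s : (Fin m → Fin r) × (Fin n → Fin r) // IsExtendedShuffle s.1 s.2},
    PiTensorProduct.lift
      ((PiTensorProduct.lift (R := 𝕜) (s := fun _ : Fin n => A)
        (E := ⨂[𝕜]^r A)).toLinearMap.compMultilinearMap (shuffleTensor 𝕜 s.2 (-c)))

/-- The map `a₀ ⊗ a₁ ⊗ ⋯ ⊗ aₘ ↦ a₀ ⊗ (a₁ ⊗ ⋯ ⊗ aₘ)` splitting off the left-most factor. -/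
def splitHead (m : ℕ) : (⨂[𝕜]^(m + 1) A) →ₗ[𝕜] A ⊗[𝕜] (⨂[𝕜]^m A) :=
  PiTensorProduct.lift (LinearMap.uncurryLeft (M := fun _ : Fin (m + 1) => A)
    { toFun := fun a => (TensorProduct.mk 𝕜 A (⨂[𝕜]^m A) a).compMultilinearMap
        (PiTensorProduct.tprod 𝕜)
      map_add' := fun a b => by ext v; simp
      map_smul' := fun t a => by ext v; simp [TensorProduct.smul_tmul'] })

/-- The map `a₀ ⊗ (a₁ ⊗ ⋯ ⊗ aₘ) ↦ a₀ ⊗ a₁ ⊗ ⋯ ⊗ aₘ`. -/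
def joinHead (m : ℕ) : A ⊗[𝕜] (⨂[𝕜]^m A) →ₗ[𝕜] (⨂[𝕜]^(m + 1) A) :=
  TensorProduct.lift
    ((PiTensorProduct.lift (R := 𝕜) (s := fun _ : Fin m => A)
      (E := ⨂[𝕜]^(m + 1) A)).toLinearMap ∘ₗ
      (PiTensorProduct.tprod 𝕜 (s := fun _ : Fin (m + 1) => A)).curryLeft)

end Shuffle

theorem splitHead_tprod {𝕜 A : Type*} [Field 𝕜] [CommRing A] [Algebra 𝕜 A] (m : ℕ)
    (a : Fin (m + 1) → A) :
    splitHead 𝕜 m (PiTensorProduct.tprod 𝕜 a)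
      = a 0 ⊗ₜ[𝕜] PiTensorProduct.tprod 𝕜 (fun i : Fin m => a i.succ) := by
  simp [splitHead, Fin.tail_def]

theorem joinHead_tmul_tprod {𝕜 A : Type*} [Field 𝕜] [CommRing A] [Algebra 𝕜 A] (m : ℕ)
    (a : A) (b : Fin m → A) :
    joinHead 𝕜 m (a ⊗ₜ[𝕜] PiTensorProduct.tprod 𝕜 b)
      = PiTensorProduct.tprod 𝕜 (Fin.cons a b : Fin (m + 1) → A) := by
  simp [joinHead]

open Classical in
theorem completeShuffle_tprod {𝕜 A : Type*} [Field 𝕜] [CommRing A] [Algebra 𝕜 A] (c : A)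
    (m n r : ℕ) (a : Fin m → A) (b : Fin n → A) :
    completeShuffle 𝕜 c m n r (PiTensorProduct.tprod 𝕜 a) (PiTensorProduct.tprod 𝕜 b)
      = ∑ s : {s : (Fin m → Fin r) × (Fin n → Fin r) // IsExtendedShuffle s.1 s.2},
          PiTensorProduct.tprod 𝕜 (shuffleWord s.1.1 s.1.2 (-c) a b) := by
  simp [completeShuffle, shuffleTensor, LinearMap.sum_apply]

/-! ### The complete shuffle algebra over a modified differential algebra -/

/-- The product of all the tensor powers `A^{⊗ k}`, `k ≥ 1`; the component of index `k` has tensor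
degree `k + 1`. -/
abbrev Shai (𝕜 A : Type*) [Field 𝕜] [CommRing A] [Algebra 𝕜 A] : Type _ :=
  ∀ k : ℕ, ⨂[𝕜]^(k + 1) A

namespace Shai

variable {𝕜 A : Type*} [Field 𝕜] [CommRing A] [Algebra 𝕜 A]

/-- The pure tensor `a₀ ⊗ ⋯ ⊗ aₙ`, as an element of the product of the tensor powers. -/
def pure {n : ℕ} (a : Fin (n + 1) → A) : Shai 𝕜 A :=
  Pi.single n (PiTensorProduct.tprod 𝕜 a)

/-- The inclusion of `A` as the tensors of degree `1`. -/
def incl (a : A) : Shai 𝕜 A := pure (n := 0) fun _ => a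

/-- The product for the weight `c`:
`(a₀ ⊗ a') (b₀ ⊗ b') = a₀ b₀ ⊗ (complete shuffle product of a' and b')`, extended to series.
Tensors of degrees `m + 1` and `n + 1` contribute only to degrees `k + 1` with `m, n ≤ k`. -/
def mul (c : A) (x y : Shai 𝕜 A) : Shai 𝕜 A := fun k =>
  ∑ m ∈ Finset.range (k + 1), ∑ n ∈ Finset.range (k + 1),
    joinHead 𝕜 k (TensorProduct.map₂ (LinearMap.mul 𝕜 A) (completeShuffle 𝕜 c m n k)
      (splitHead 𝕜 m (x m)) (splitHead 𝕜 n (y n)))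

/-- The operator `a ↦ 1 ⊗ a`. -/
def P (x : Shai 𝕜 A) : Shai 𝕜 A
  | 0 => 0
  | k + 1 => joinHead 𝕜 (k + 1) (1 ⊗ₜ[𝕜] x k)

/-- The map applying `f` to the left-most tensor factor. -/
def mapHead (f : A →ₗ[𝕜] A) (m : ℕ) : (⨂[𝕜]^(m + 1) A) →ₗ[𝕜] (⨂[𝕜]^(m + 1) A) :=
  joinHead 𝕜 m ∘ₗ LinearMap.rTensor _ f ∘ₗ splitHead 𝕜 m

/-- The map `a₀ ⊗ a₁ ⊗ a₂ ⊗ ⋯ ↦ a₀ a₁ ⊗ a₂ ⊗ ⋯`. -/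
def mergeHead (m : ℕ) : (⨂[𝕜]^(m + 2) A) →ₗ[𝕜] (⨂[𝕜]^(m + 1) A) :=
  joinHead 𝕜 m ∘ₗ LinearMap.rTensor _ (LinearMap.mul' 𝕜 A) ∘ₗ
    (TensorProduct.assoc 𝕜 A A (⨂[𝕜]^m A)).symm.toLinearMap ∘ₗ
    LinearMap.lTensor A (splitHead 𝕜 m) ∘ₗ splitHead 𝕜 (m + 1)

/-- The operator with `D a₀ = d a₀` and, in tensor degree at least two,
`D (a₀ ⊗ a₁ ⊗ ⋯) = d a₀ ⊗ a₁ ⊗ ⋯ + a₀ a₁ ⊗ ⋯ - (d 1) a₀ ⊗ a₁ ⊗ ⋯`. -/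
def D (d : A →ₗ[𝕜] A) (x : Shai 𝕜 A) : Shai 𝕜 A
  | 0 => mapHead d 0 (x 0) + mergeHead 0 (x 1)
  | k + 1 => mapHead d (k + 1) (x (k + 1)) + mergeHead (k + 1) (x (k + 2))
      - mapHead (LinearMap.mulLeft 𝕜 (d 1)) (k + 1) (x (k + 1))

/-- An isomorphism from the complete shuffle algebra of `(A, d)` (the product of the tensor powers
`A^{⊗ k}`, `k ≥ 1`, with the complete shuffle product for the weight `d 1`, the filtration by tensor
degree, the operators `D` and `P`, and the inclusion of `A`) onto `(R, F, D', P')`. -/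
structure IsIso {R : Type*} [Ring R] [Algebra A R] [Module 𝕜 R] (d : A →ₗ[𝕜] A)
    (F : ℕ → Submodule A R) (D' P' : R →ₗ[𝕜] R) (φ : Shai 𝕜 A ≃ₗ[𝕜] R) : Prop where
  map_mul : ∀ x y, φ (mul (d 1) x y) = φ x * φ y
  map_incl : ∀ a, φ (incl a) = algebraMap A R a
  map_D : ∀ x, φ (D d x) = D' (φ x)
  map_P : ∀ x, φ (P x) = P' (φ x)
  map_filtration : ∀ n x, (∀ k < n, x k = 0) ↔ φ x ∈ F n

end Shai

/-! ### Separable Volterra operators on formal power series -/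

/-- Term-by-term integration from `0` to `x`. -/
def psIntegral : ℝ⟦X⟧ →ₗ[ℝ] ℝ⟦X⟧ where
  toFun f := PowerSeries.mk fun n => if n = 0 then 0 else PowerSeries.coeff (n - 1) f / n
  map_add' f g := by
    ext n
    by_cases hn : n = 0 <;> simp [hn, add_div]
  map_smul' c f := by
    ext n
    by_cases hn : n = 0 <;> simp [hn, mul_div_assoc]

/-- `D_K f = (1 / h) (f / k)'` for the kernel `K(x, t) = k(x) h(t)`. -/
def volterraD (k h : ℝ⟦X⟧) : ℝ⟦X⟧ →ₗ[ℝ] ℝ⟦X⟧ :=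
  LinearMap.mulLeft ℝ h⁻¹ ∘ₗ (PowerSeries.derivative ℝ).toLinearMap ∘ₗ LinearMap.mulLeft ℝ k⁻¹

/-- `P_K f = k(x) ∫₀ˣ h(t) f(t) dt` for the kernel `K(x, t) = k(x) h(t)`. -/
def volterraP (k h : ℝ⟦X⟧) : ℝ⟦X⟧ →ₗ[ℝ] ℝ⟦X⟧ :=
  LinearMap.mulLeft ℝ k ∘ₗ psIntegral ∘ₗ LinearMap.mulLeft ℝ h

/-- The `x`-adic filtration `x^n ℝ[[x]]`. -/
def xAdic (n : ℕ) : Submodule ℝ ℝ⟦X⟧ :=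
  (Ideal.span {(PowerSeries.X : ℝ⟦X⟧) ^ n}).restrictScalars ℝ

end

/-! ### Complete filtrations -/

section CompleteFiltration

variable {A R : Type*} [CommRing A] [AddCommGroup R] [Module A R] {F : ℕ → Submodule A R}

/-! Since `h` is `μ` times the derivative of `1/k`, the series `D_K 1` is the constant `w = μ⁻¹`,
and `P_K` inverts `D_K` on series without constant term. `IsVolterraPair` records these facts with
the shift of `x`-adic order; claims 1–3 use nothing else. The Reynolds identity follows by applying
`P D` to `P f * P g`.

Put `T f = D (f - f(0))`. Then `f = f(0) + P (T f)`, and iterating gives `f = ∑ cₙ Pⁿ(1)` with `cₙ =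
(Tⁿ f)(0)`. So the `Pⁿ(1)` form a topological basis adapted to the filtration
(`mem_xAdic_iff_coeff`, `coeffEquiv`). A morphism must send `Pⁿ(1)` to `P'ⁿ(1)`; the resulting limit
map is multiplicative because the Reynolds identities on both sides push its defect into every
filtration step (`isFreeCCMDRA`).

Tensor powers of `ℝ` are lines, so `Sh(ℝ)` is also a space of sequences. Classifying extended
shuffles by their first letter gives a recursion for its structure constants
(`shuffleCoeff_succ_succ_succ`), and the twisted Leibniz rule of `T` gives the same one (`tail_mul`,
`coeff_mul`).

For the closed form, `L = ln (k(0)/k)` satisfies `μ L' = k h`. Differentiating the exponential tail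
from `n + 1` gives the tail from `n`, so `D_K` carries the claimed formula for `n + 1` to that for
`n`. -/

theorem IsCompleteFiltration.eq_zero (hF : IsCompleteFiltration F) {x : R}
    (hx : ∀ n, x ∈ F n) : x = 0 := by
  obtain ⟨hF, hb⟩ := hF
  apply hb.1
  rw [map_zero]
  ext n
  exact (Submodule.Quotient.mk_eq_zero (F n)).2 (hx n)

theorem IsCompleteFiltration.exists_limit (hF : IsCompleteFiltration F) (s : ℕ → R)
    (hs : ∀ m n, m ≤ n → s n - s m ∈ F m) : ∃ x, ∀ n, x - s n ∈ F n := by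
  obtain ⟨hF, hb⟩ := hF
  obtain ⟨x, hx⟩ := hb.2 ⟨fun n => (F n).mkQ (s n), fun m n hmn =>
    (Submodule.Quotient.eq (F m)).2 (hs m n hmn)⟩
  refine ⟨x, fun n => ?_⟩
  have := congrFun (congrArg Subtype.val hx) n
  exact (Submodule.Quotient.eq (F n)).1 this

theorem isCompleteFiltration_of_exists_limit (hF : Antitone F)
    (h0 : ∀ x, (∀ n, x ∈ F n) → x = 0)
    (hl : ∀ s : ℕ → R, (∀ m n, m ≤ n → s n - s m ∈ F m) → ∃ x, ∀ n, x - s n ∈ F n) :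
    IsCompleteFiltration F := by
  refine ⟨hF, (injective_iff_map_eq_zero _).2 fun x hx => h0 x fun n => ?_, fun s => ?_⟩
  · exact (Submodule.Quotient.mk_eq_zero (F n)).1 (congrFun (congrArg Subtype.val hx) n)
  · choose t ht using fun n => Submodule.mkQ_surjective (F n) (s.1 n)
    obtain ⟨x, hx⟩ := hl t fun m n hmn => by
      have h1 := s.2 m n hmn
      rw [← ht n, ← ht m] at h1
      exact (Submodule.Quotient.eq (F m)).1 h1
    refine ⟨x, Subtype.ext (funext fun n => ?_)⟩
    rw [← ht n]
    exact (Submodule.Quotient.eq (F n)).2 (hx n)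

/-- The complement is a union of cosets of `F n`. This makes the closure in the operator filtration
harmless in the `x`-adic case. -/
theorem isClosed_filtrationTopology (F : ℕ → Submodule A R) (n : ℕ) :
    @IsClosed R (filtrationTopology F) (F n : Set R) := by
  let _ := filtrationTopology F
  refine ⟨?_⟩
  have h : ((F n : Set R))ᶜ = ⋃ x ∈ (F n : Set R)ᶜ, {y | y - x ∈ F n} := by
    ext y
    simp only [Set.mem_compl_iff, SetLike.mem_coe, Set.mem_iUnion, Set.mem_ofPred_eq, exists_prop]
    refine ⟨fun hy => ⟨y, hy, by simp⟩, fun ⟨x, hx, hyx⟩ hy => hx ?_⟩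
    simpa using (F n).sub_mem hy hyx
  rw [h]
  exact isOpen_biUnion fun x _ => TopologicalSpace.isOpen_generateFrom_of_mem ⟨x, n, rfl⟩

/-- Drives every induction into an arbitrary target: each application of `P` gains one filtration
step, and completeness then kills defects lying in all steps. -/
theorem IsCompatibleComplete.map_mem {𝕜 : Type*} [Field 𝕜] [Module 𝕜 R] {P : R →ₗ[𝕜] R}
    (h : IsCompatibleComplete F P) {n : ℕ} {x : R} (hx : x ∈ F n) : P x ∈ F (n + 1) := by
  let _ := filtrationTopology F
  rw [← SetLike.mem_coe, h.compatible]
  refine subset_closure (Submodule.subset_span ⟨x, ?_, rfl⟩)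
  rw [← h.compatible]
  exact hx

theorem IsCompatibleComplete.mem_zero {𝕜 : Type*} [Field 𝕜] [Module 𝕜 R] {P : R →ₗ[𝕜] R}
    (h : IsCompatibleComplete F P) (x : R) : x ∈ F 0 := by
  rw [← SetLike.mem_coe, h.compatible]
  trivial

end CompleteFiltration

/-! ### The `x`-adic filtration -/

theorem mem_xAdic_iff {n : ℕ} {f : ℝ⟦X⟧} :
    f ∈ xAdic n ↔ ∀ m < n, PowerSeries.coeff m f = 0 := by
  rw [xAdic, Submodule.restrictScalars_mem, Ideal.mem_span_singleton, PowerSeries.X_pow_dvd_iff]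

theorem mul_mem_xAdic {n : ℕ} (g : ℝ⟦X⟧) {f : ℝ⟦X⟧} (hf : f ∈ xAdic n) : g * f ∈ xAdic n :=
  Ideal.mul_mem_left _ g hf

theorem xAdic_antitone : Antitone xAdic := fun _ _ hmn _ hf =>
  mem_xAdic_iff.2 fun j hj => mem_xAdic_iff.1 hf j (hj.trans_le hmn)

theorem isCompleteFiltration_xAdic : IsCompleteFiltration xAdic := by
  refine isCompleteFiltration_of_exists_limit xAdic_antitone (fun f hf => ?_) fun s hs => ?_
  · ext n
    exact mem_xAdic_iff.1 (hf (n + 1)) n n.lt_succ_self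
  · refine ⟨PowerSeries.mk fun n => PowerSeries.coeff n (s (n + 1)), fun n => ?_⟩
    refine mem_xAdic_iff.2 fun m hm => ?_
    have := mem_xAdic_iff.1 (hs (m + 1) n hm) m m.lt_succ_self
    rw [map_sub, sub_eq_zero] at this
    rw [map_sub, PowerSeries.coeff_mk, this, sub_self]

/-! ### Pairs of operators of Volterra type on power series -/

/-- `D` is a modified differential operator of scalar weight `w` and `P` is the section of `D` with
values in the power series without constant term; `P` raises and `D` lowers the `x`-adic order. -/
structure IsVolterraPair (w : ℝ) (D P : ℝ⟦X⟧ →ₗ[ℝ] ℝ⟦X⟧) : Prop where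
  D_P : ∀ f, D (P f) = f
  P_D : ∀ f, PowerSeries.constantCoeff f = 0 → P (D f) = f
  coeff_P : ∀ f, PowerSeries.constantCoeff (P f) = 0
  D_one : D 1 = PowerSeries.C w
  D_mul : ∀ f g, D (f * g) = D f * g + f * D g - PowerSeries.C w * (f * g)
  P_mem : ∀ n, ∀ f ∈ xAdic n, P f ∈ xAdic (n + 1)
  D_mem : ∀ n, ∀ f ∈ xAdic (n + 1), D f ∈ xAdic n

/-! ### Integration, differentiation and the separable Volterra operators. -/

theorem coeff_psIntegral_zero (f : ℝ⟦X⟧) : PowerSeries.coeff 0 (psIntegral f) = 0 := by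
  simp [psIntegral]

theorem coeff_psIntegral_succ (f : ℝ⟦X⟧) (n : ℕ) :
    PowerSeries.coeff (n + 1) (psIntegral f) = PowerSeries.coeff n f / (n + 1) := by
  simp [psIntegral]

theorem derivative_psIntegral (f : ℝ⟦X⟧) : PowerSeries.derivative ℝ (psIntegral f) = f := by
  ext n
  rw [PowerSeries.coeff_derivative, coeff_psIntegral_succ]
  exact div_mul_cancel₀ _ (by positivity)

theorem psIntegral_derivative {f : ℝ⟦X⟧} (hf : PowerSeries.constantCoeff f = 0) :
    psIntegral (PowerSeries.derivative ℝ f) = f := by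
  apply PowerSeries.derivative.ext
  · rw [derivative_psIntegral]
  · rw [hf, ← PowerSeries.coeff_zero_eq_constantCoeff_apply, coeff_psIntegral_zero]

theorem psIntegral_mem_xAdic {n : ℕ} {f : ℝ⟦X⟧} (hf : f ∈ xAdic n) :
    psIntegral f ∈ xAdic (n + 1) := by
  refine mem_xAdic_iff.2 fun m hm => ?_
  cases m with
  | zero => exact coeff_psIntegral_zero f
  | succ m =>
    rw [coeff_psIntegral_succ, mem_xAdic_iff.1 hf m (Nat.lt_of_succ_lt_succ hm), zero_div]

theorem derivative_mem_xAdic {n : ℕ} {f : ℝ⟦X⟧} (hf : f ∈ xAdic (n + 1)) :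
    PowerSeries.derivative ℝ f ∈ xAdic n := by
  refine mem_xAdic_iff.2 fun m hm => ?_
  rw [PowerSeries.coeff_derivative, mem_xAdic_iff.1 hf (m + 1) (Nat.succ_lt_succ hm), zero_mul]

theorem volterraD_apply (k h f : ℝ⟦X⟧) :
    volterraD k h f = h⁻¹ * PowerSeries.derivative ℝ (k⁻¹ * f) := rfl

theorem volterraP_apply (k h f : ℝ⟦X⟧) : volterraP k h f = k * psIntegral (h * f) := rfl

/-- The constant term of `(1/k)' = -k'/k²` is minus the coefficient of `x` in `k`, divided by
`k(0)²`. -/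
theorem constantCoeff_derivative_inv_ne_zero {k : ℝ⟦X⟧}
    (hk₀ : PowerSeries.constantCoeff k ≠ 0) (hk₁ : PowerSeries.coeff 1 k ≠ 0) :
    PowerSeries.constantCoeff (PowerSeries.derivative ℝ k⁻¹) ≠ 0 := by
  have h1 : PowerSeries.constantCoeff (PowerSeries.derivative ℝ k) = PowerSeries.coeff 1 k := by
    rw [← PowerSeries.coeff_zero_eq_constantCoeff_apply, PowerSeries.coeff_derivative]
    simp
  rw [PowerSeries.derivative_inv', map_mul, map_neg, map_pow, PowerSeries.constantCoeff_inv, h1]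
  exact mul_ne_zero (neg_ne_zero.2 (pow_ne_zero _ (inv_ne_zero hk₀))) hk₁

/-- With `u = 1/k` one has `(ufg)' = (uf)'g + f(ug)' - u'fg`, and `u'/h = μ⁻¹`; this is the modified
Leibniz rule of constant weight. -/
theorem isVolterraPair_volterra {k h : ℝ⟦X⟧} {μ : ℝ} (hk₀ : PowerSeries.constantCoeff k ≠ 0)
    (hμ : μ ≠ 0) (hh₀ : PowerSeries.constantCoeff h ≠ 0)
    (hh : h = μ • PowerSeries.derivative ℝ k⁻¹) :
    IsVolterraPair μ⁻¹ (volterraD k h) (volterraP k h) := by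
  have hk : k⁻¹ * k = 1 := PowerSeries.inv_mul_cancel k hk₀
  have hhi : h⁻¹ * h = 1 := PowerSeries.inv_mul_cancel h hh₀
  have hd : PowerSeries.derivative ℝ k⁻¹ = PowerSeries.C μ⁻¹ * h := by
    rw [hh, ← PowerSeries.smul_eq_C_mul, smul_smul, inv_mul_cancel₀ hμ, one_smul]
  refine ⟨fun f => ?_, fun f hf => ?_, fun f => ?_, ?_, fun f g => ?_, fun n f hf => ?_,
    fun n f hf => ?_⟩
  · rw [volterraP_apply, volterraD_apply, ← mul_assoc, hk, one_mul, derivative_psIntegral,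
      ← mul_assoc, hhi, one_mul]
  · rw [volterraP_apply, volterraD_apply, ← mul_assoc h, mul_comm h, hhi, one_mul,
      psIntegral_derivative (by rw [map_mul, hf, mul_zero]), ← mul_assoc, mul_comm k, hk, one_mul]
  · rw [volterraP_apply, map_mul, ← PowerSeries.coeff_zero_eq_constantCoeff_apply (psIntegral _),
      coeff_psIntegral_zero, mul_zero]
  · rw [volterraD_apply, mul_one, hd, mul_left_comm, hhi, mul_one]
  · simp only [volterraD_apply, Derivation.leibniz, hd, smul_eq_mul]
    linear_combination (-(f * g * PowerSeries.C μ⁻¹)) * hhi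
  · exact mul_mem_xAdic _ (psIntegral_mem_xAdic (mul_mem_xAdic _ hf))
  · exact mul_mem_xAdic _ (derivative_mem_xAdic (mul_mem_xAdic _ hf))

namespace IsVolterraPair

variable {w : ℝ} {D P : ℝ⟦X⟧ →ₗ[ℝ] ℝ⟦X⟧}

theorem isModifiedDifferentialReynolds (H : IsVolterraPair w D P) :
    IsModifiedDifferentialReynolds D P where
  differential f g := by rw [H.D_mul, H.D_one]; ring
  section_eq := H.D_P
  reynolds f g := by
    -- The product has no constant term, so `P D` fixes it; the modified Leibniz rule inside `P`
    -- yields the three Reynolds terms.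
    have h0 : PowerSeries.constantCoeff (P f * P g) = 0 := by rw [map_mul, H.coeff_P, zero_mul]
    rw [← H.P_D _ h0, H.D_mul, H.D_P, H.D_P, H.D_one, ← map_add, ← map_sub]
    congr 1
    ring

theorem isCompatibleComplete (H : IsVolterraPair w D P) : IsCompatibleComplete xAdic P where
  complete := isCompleteFiltration_xAdic
  operated n f hf := xAdic_antitone n.le_succ (H.P_mem n f hf)
  compatible n := by
    let _ := filtrationTopology xAdic
    induction n with
    | zero =>
      ext f
      simp [operatorFiltration, mem_xAdic_iff]
    | succ n ih =>
      -- The image is already a closed submodule, so neither span nor closure enlarges it; `D`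
      -- supplies preimages.
      have h : P '' (xAdic n : Set ℝ⟦X⟧) = xAdic (n + 1) := by
        ext f
        constructor
        · rintro ⟨g, hg, rfl⟩
          exact H.P_mem n g hg
        · intro hf
          refine ⟨D f, H.D_mem n f hf, H.P_D f ?_⟩
          rw [← PowerSeries.coeff_zero_eq_constantCoeff_apply]
          exact mem_xAdic_iff.1 hf 0 n.succ_pos
      rw [operatorFiltration, ← ih, h, Submodule.span_eq]
      exact (isClosed_filtrationTopology xAdic (n + 1)).closure_eq.symm

theorem isCCMDRA (H : IsVolterraPair w D P) :
    IsCCMDRA (w • (LinearMap.id : ℝ →ₗ[ℝ] ℝ)) xAdic D P where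
  base a b := by simp; ring
  map_base a := by
    have : (algebraMap ℝ ℝ⟦X⟧ a) = a • 1 := Algebra.algebraMap_eq_smul_one a
    rw [this, map_smul, H.D_one, PowerSeries.smul_eq_C_mul]
    simp [mul_comm, PowerSeries.algebraMap_eq]
  compatibleComplete := H.isCompatibleComplete
  reynolds := H.isModifiedDifferentialReynolds

end IsVolterraPair

/-! ### Expansions in the iterates `Pⁿ(1)`, and initiality. -/

/-- Pointwise limits exist by completeness; their failure to be linear lies in every `F n`, hence
vanishes. -/
theorem IsCompleteFiltration.exists_linearMap {A M R : Type*} [CommRing A] [AddCommGroup M]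
    [Module A M] [AddCommGroup R] [Module A R] {F : ℕ → Submodule A R}
    (hF : IsCompleteFiltration F) (s : ℕ → M →ₗ[A] R)
    (hs : ∀ x m n, m ≤ n → s n x - s m x ∈ F m) :
    ∃ f : M →ₗ[A] R, ∀ x n, f x - s n x ∈ F n := by
  choose f hf using fun x => hF.exists_limit (fun n => s n x) (hs x)
  refine ⟨⟨⟨f, fun x y => ?_⟩, fun c x => ?_⟩, hf⟩
  · refine sub_eq_zero.1 (hF.eq_zero fun n => ?_)
    have := (F n).sub_mem (hf (x + y) n) ((F n).add_mem (hf x n) (hf y n))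
    convert this using 1
    rw [map_add]
    abel
  · refine sub_eq_zero.1 (hF.eq_zero fun n => ?_)
    have := (F n).sub_mem (hf (c • x) n) ((F n).smul_mem c (hf x n))
    convert this using 1
    rw [map_smul, smul_sub, RingHom.id_apply]
    abel

/-- The operator `f ↦ D (f - f(0))`. -/
noncomputable def volterraTail (D : ℝ⟦X⟧ →ₗ[ℝ] ℝ⟦X⟧) : ℝ⟦X⟧ →ₗ[ℝ] ℝ⟦X⟧ :=
  D ∘ₗ (LinearMap.id - (PowerSeries.coeff (R := ℝ) 0).smulRight 1)

/-- The coefficients of the expansion `f = ∑ cₙ Pⁿ(1)`. -/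
noncomputable def volterraCoeff (D : ℝ⟦X⟧ →ₗ[ℝ] ℝ⟦X⟧) (n : ℕ) : ℝ⟦X⟧ →ₗ[ℝ] ℝ :=
  PowerSeries.coeff (R := ℝ) 0 ∘ₗ volterraTail D ^ n

theorem volterraTail_apply (D : ℝ⟦X⟧ →ₗ[ℝ] ℝ⟦X⟧) (f : ℝ⟦X⟧) :
    volterraTail D f = D (f - PowerSeries.coeff 0 f • 1) := rfl

theorem volterraCoeff_zero (D : ℝ⟦X⟧ →ₗ[ℝ] ℝ⟦X⟧) (f : ℝ⟦X⟧) :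
    volterraCoeff D 0 f = PowerSeries.coeff 0 f := rfl

theorem volterraCoeff_succ (D : ℝ⟦X⟧ →ₗ[ℝ] ℝ⟦X⟧) (n : ℕ) (f : ℝ⟦X⟧) :
    volterraCoeff D (n + 1) f = volterraCoeff D n (volterraTail D f) := by
  simp [volterraCoeff, pow_succ]

theorem mem_xAdic_zero (f : ℝ⟦X⟧) : f ∈ xAdic 0 := mem_xAdic_iff.2 fun _ h => absurd h (by simp)

namespace IsVolterraPair

variable {w : ℝ} {D P : ℝ⟦X⟧ →ₗ[ℝ] ℝ⟦X⟧}

theorem coeff_zero_P (H : IsVolterraPair w D P) (f : ℝ⟦X⟧) : PowerSeries.coeff 0 (P f) = 0 := by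
  rw [PowerSeries.coeff_zero_eq_constantCoeff_apply, H.coeff_P]

theorem tail_P (H : IsVolterraPair w D P) (f : ℝ⟦X⟧) : volterraTail D (P f) = f := by
  rw [volterraTail_apply, H.coeff_zero_P, zero_smul, sub_zero, H.D_P]

theorem tail_one : volterraTail D 1 = 0 := by
  simp [volterraTail_apply]

/-- `P D` fixes `f - f(0)`. This is one step of the expansion in the `Pⁿ(1)`. -/
theorem eq_add_P_tail (H : IsVolterraPair w D P) (f : ℝ⟦X⟧) :
    f = PowerSeries.coeff 0 f • 1 + P (volterraTail D f) := by
  rw [volterraTail_apply, H.P_D, add_sub_cancel]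
  simp [PowerSeries.smul_eq_C_mul]

theorem D_eq (H : IsVolterraPair w D P) (f : ℝ⟦X⟧) :
    D f = (w * PowerSeries.coeff 0 f) • 1 + volterraTail D f := by
  rw [volterraTail_apply, map_sub, map_smul, H.D_one, PowerSeries.smul_eq_C_mul,
    PowerSeries.smul_eq_C_mul, map_mul]
  ring

theorem coeff_P_zero (H : IsVolterraPair w D P) (f : ℝ⟦X⟧) : volterraCoeff D 0 (P f) = 0 :=
  H.coeff_zero_P f

theorem coeff_P_succ (H : IsVolterraPair w D P) (n : ℕ) (f : ℝ⟦X⟧) :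
    volterraCoeff D (n + 1) (P f) = volterraCoeff D n f := by
  rw [volterraCoeff_succ, H.tail_P]

theorem coeff_one_succ (n : ℕ) : volterraCoeff D (n + 1) 1 = 0 := by
  rw [volterraCoeff_succ, tail_one, map_zero]

theorem coeff_one_zero : volterraCoeff D 0 1 = 1 := by
  simp [volterraCoeff_zero]

theorem coeff_P_pow (H : IsVolterraPair w D P) (n m : ℕ) :
    volterraCoeff D m ((P ^ n) 1) = if m = n then 1 else 0 := by
  induction n generalizing m with
  | zero =>
    cases m with
    | zero => simpa using coeff_one_zero
    | succ m => simpa using coeff_one_succ m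
  | succ n ih =>
    rw [pow_succ', Module.End.mul_apply]
    cases m with
    | zero => simpa using H.coeff_P_zero _
    | succ m => simp [H.coeff_P_succ, ih]

/-- The expansion is triangular: once the leading coefficient is zero, `f = P (T f)`, and `D` lowers
while `P` raises the order by one. -/
theorem mem_xAdic_iff_coeff (H : IsVolterraPair w D P) {n : ℕ} {f : ℝ⟦X⟧} :
    f ∈ xAdic n ↔ ∀ k < n, volterraCoeff D k f = 0 := by
  induction n generalizing f with
  | zero => simp [mem_xAdic_zero]
  | succ n ih =>
    constructor
    · intro hf k hk
      have h0 : PowerSeries.coeff 0 f = 0 := mem_xAdic_iff.1 hf 0 n.succ_pos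
      cases k with
      | zero => exact h0
      | succ k =>
        rw [volterraCoeff_succ]
        refine ih.1 ?_ k (Nat.lt_of_succ_lt_succ hk)
        rw [volterraTail_apply, h0, zero_smul, sub_zero]
        exact H.D_mem n f hf
    · intro hf
      have h0 : PowerSeries.coeff 0 f = 0 := hf 0 n.succ_pos
      rw [H.eq_add_P_tail f, h0, zero_smul, zero_add]
      refine H.P_mem n _ (ih.2 fun k hk => ?_)
      rw [← volterraCoeff_succ]
      exact hf (k + 1) (Nat.succ_lt_succ hk)

/-- The linear map `∑ cₙ Pⁿ(1) ↦ ∑ cₙ P'ⁿ(1)` into a compatible complete operated algebra. -/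
theorem exists_linearMap (H : IsVolterraPair w D P) {S : Type*} [CommRing S] [Algebra ℝ S]
    {F : ℕ → Submodule ℝ S} {P' : S →ₗ[ℝ] S} (hS : IsCompatibleComplete F P') :
    ∃ f : ℝ⟦X⟧ →ₗ[ℝ] S, f 1 = 1 ∧ (∀ x, f (P x) = P' (f x)) := by
  have hpow : ∀ j, (P' ^ j) 1 ∈ F j := by
    intro j
    induction j with
    | zero => exact hS.mem_zero _
    | succ j ih =>
      rw [pow_succ', Module.End.mul_apply]
      exact hS.map_mem ih
  have hanti : Antitone F := hS.complete.1
  obtain ⟨f, hf⟩ := hS.complete.exists_linearMap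
    (fun n => ∑ j ∈ Finset.range n, (volterraCoeff D j).smulRight ((P' ^ j) 1)) (by
      intro x m n hmn
      simp only [LinearMap.sum_apply]
      rw [← Finset.sum_range_add_sum_Ico _ hmn, add_sub_cancel_left]
      exact (F m).sum_mem fun j hj => (F m).smul_mem _ (hanti (Finset.mem_Ico.1 hj).1 (hpow j)))
  simp only [LinearMap.sum_apply, LinearMap.smulRight_apply] at hf
  refine ⟨f, ?_, fun x => ?_⟩
  · refine sub_eq_zero.1 (hS.complete.eq_zero fun n => hanti n.le_succ ?_)
    have := hf 1 (n + 1)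
    rw [Finset.sum_range_succ'] at this
    simpa [coeff_one_succ, coeff_one_zero] using this
  · refine sub_eq_zero.1 (hS.complete.eq_zero fun n => hanti n.le_succ ?_)
    -- As `P` shifts coefficients, the partial sum of length `n + 1` at `P x` is `P'` of the partial
    -- sum of length `n` at `x`.
    have h1 := hf (P x) (n + 1)
    have h2 := hS.map_mem (hf x n)
    rw [Finset.sum_range_succ', H.coeff_P_zero, zero_smul, add_zero] at h1
    simp only [H.coeff_P_succ] at h1
    rw [map_sub, map_sum] at h2
    have h3 : ∀ j, P' (volterraCoeff D j x • (P' ^ j) 1)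
        = volterraCoeff D j x • (P' ^ (j + 1)) 1 := fun j => by
      rw [map_smul, pow_succ' P' j, Module.End.mul_apply]
    simp only [h3] at h2
    have h4 := (F (n + 1)).sub_mem h1 h2
    rwa [sub_sub_sub_cancel_right] at h4

theorem isFreeCCMDRA (H : IsVolterraPair w D P) :
    IsFreeCCMDRA.{u} (w • (LinearMap.id : ℝ →ₗ[ℝ] ℝ)) xAdic D P := by
  refine ⟨H.isCCMDRA, ?_⟩
  intro S _ algA algK tower F' D' P' hS
  -- Base algebra and ground field are both `ℝ`, so `S` carries two `ℝ`-algebra structures; the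
  -- scalar tower identifies them.
  obtain rfl : algA = algK := by
    refine Algebra.algebra_ext _ _ fun r => ?_
    have h1 := @IsScalarTower.algebraMap_apply ℝ ℝ S _ _ _ _ algA algK tower r
    exact h1.symm
  have hC := hS.compatibleComplete
  have hR := hS.reynolds
  have hD1 : D' 1 = w • 1 := by
    have := hS.map_base 1
    rw [map_one (algebraMap ℝ S)] at this
    rw [← this, Algebra.algebraMap_eq_smul_one]
    simp
  obtain ⟨f, hf1, hfP⟩ := H.exists_linearMap hC
  -- Constant terms cause no defect, since `f` is linear and unital. For the rest, the Reynolds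
  -- identities of equal weight write the defect as `P'` of a combination of defects, which gains
  -- one step.
  have hmul : ∀ n x y, f (x * y) - f x * f y ∈ F' n := by
    intro n
    induction n with
    | zero => exact fun _ _ => hC.mem_zero _
    | succ n ih =>
      intro x y
      set x₁ := volterraTail D x
      set y₁ := volterraTail D y
      have hx : x = PowerSeries.coeff 0 x • 1 + P x₁ := H.eq_add_P_tail x
      have hy : y = PowerSeries.coeff 0 y • 1 + P y₁ := H.eq_add_P_tail y
      have e : f (x * y) - f x * f y = f (P x₁ * P y₁) - f (P x₁) * f (P y₁) := by
        rw [hx, hy]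
        simp only [add_mul, mul_add, map_add, smul_mul_assoc, mul_smul_comm, one_mul, mul_one,
          map_smul, hf1]
        abel
      rw [e, H.isModifiedDifferentialReynolds.reynolds, hfP x₁, hfP y₁, hR.reynolds, hD1, H.D_one]
      have h1 := ih (P x₁) y₁
      have h2 := ih x₁ (P y₁)
      have h3 := (F' n).smul_mem w (ih (P x₁) (P y₁))
      have h4 := hC.map_mem ((F' n).sub_mem ((F' n).add_mem h1 h2) h3)
      convert h4 using 1
      have e2 : P x₁ * PowerSeries.C w * P y₁ = w • (P x₁ * P y₁) := by
        rw [PowerSeries.smul_eq_C_mul]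
        ring
      rw [e2]
      simp only [hfP, map_sub, map_add, map_smul, mul_smul_comm, smul_mul_assoc, mul_one, smul_sub]
      abel
  let φ : ℝ⟦X⟧ →ₐ[ℝ] S := AlgHom.ofLinearMap f hf1 fun x y =>
    sub_eq_zero.1 (hC.complete.eq_zero fun n => hmul n x y)
  have hφ : ∀ x, φ x = f x := fun _ => rfl
  refine ⟨φ, ⟨fun x => ?_, hfP, fun n => ?_⟩, fun ψ hψ => ?_⟩
  -- Both sides equal `w x(0) + f (T x)`: `D'` undoes `P'`, and `D' 1 = w`.
  · simp only [hφ]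
    conv_rhs => rw [H.eq_add_P_tail x]
    rw [H.D_eq, map_add, map_add, map_add, hfP, hR.section_eq, map_smul, map_smul, map_smul, hf1,
      hD1, smul_smul, mul_comm]
  · simp only [hφ]
    induction n with
    | zero => exact fun x _ => hC.mem_zero _
    | succ n ih =>
      intro x hx
      have h0 : PowerSeries.constantCoeff x = 0 := by
        rw [← PowerSeries.coeff_zero_eq_constantCoeff_apply]
        exact mem_xAdic_iff.1 hx 0 n.succ_pos
      rw [← H.P_D x h0, hfP]
      exact hC.map_mem (ih _ (H.D_mem n x hx))
  -- Two morphisms agree on the constant term, so their difference at `x` is `P'` of their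
  -- difference at `T x`.
  · refine AlgHom.ext fun x => sub_eq_zero.1 (hC.complete.eq_zero fun n => ?_)
    induction n generalizing x with
    | zero => exact hC.mem_zero _
    | succ n ih =>
      have h := hC.map_mem (ih (volterraTail D x))
      rw [map_sub, ← hψ.map_P, hφ, ← hfP, ← hφ] at h
      rw [H.eq_add_P_tail x, map_add, map_add, map_smul, map_smul, map_one, map_one,
        add_sub_add_left_eq_sub]
      exact h

end IsVolterraPair

/-! ### Counting extended shuffles -/

/-- The extended shuffles of length `r` of words of lengths `m` and `n`. -/
abbrev ExtendedShuffle (m n r : ℕ) : Type :=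
  {s : (Fin m → Fin r) × (Fin n → Fin r) // IsExtendedShuffle s.1 s.2}

namespace ExtendedShuffle

/-- Interchanging the two words. -/
def swap {m n r : ℕ} (s : ExtendedShuffle m n r) : ExtendedShuffle n m r :=
  ⟨s.1.swap, s.2.right, s.2.left, fun i j h => s.2.disjoint j i h.symm,
    fun l hp hq => (s.2.inserted l hq hp).symm⟩

theorem swap_swap {m n r : ℕ} (s : ExtendedShuffle m n r) : s.swap.swap = s := rfl

theorem card_swap (m n r : ℕ) :
    Nat.card (ExtendedShuffle m n r) = Nat.card (ExtendedShuffle n m r) :=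
  Nat.card_congr ⟨swap, swap, swap_swap, swap_swap⟩

/-- Prepending a letter to the first word. -/
def consLeft {m n r : ℕ} (s : ExtendedShuffle m n r) : ExtendedShuffle (m + 1) n (r + 1) :=
  ⟨(Fin.cons 0 fun i => (s.1.1 i).succ, fun j => (s.1.2 j).succ), by
    refine ⟨?_, fun i j hij => Fin.succ_lt_succ_iff.2 (s.2.right hij), fun i j => ?_, fun l => ?_⟩
    · intro i j hij
      induction j using Fin.cases with
      | zero => exact absurd hij (Fin.not_lt_zero i)
      | succ j =>
        induction i using Fin.cases with
        | zero => simp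
        | succ i =>
          simpa using s.2.left (Fin.succ_lt_succ_iff.1 hij)
    · induction i using Fin.cases with
      | zero => simpa using (Fin.succ_ne_zero _).symm
      | succ i => simpa using s.2.disjoint i j
    · intro hp hq
      induction l using Fin.cases with
      | zero => exact absurd rfl (hp 0)
      | succ l =>
        obtain ⟨⟨i, hi⟩, j, hj⟩ := s.2.inserted l
          (fun i h => hp i.succ (by simp [h])) (fun j h => hq j (by simp [h]))
        exact ⟨⟨i.succ, by simpa using hi⟩, j, by simpa using hj⟩⟩

/-- Prepending a letter to the second word. -/
def consRight {m n r : ℕ} (s : ExtendedShuffle m n r) : ExtendedShuffle m (n + 1) (r + 1) :=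
  s.swap.consLeft.swap

/-- Prepending an inserted letter. -/
def consInserted {m n r : ℕ} (s : ExtendedShuffle (m + 1) (n + 1) r) :
    ExtendedShuffle (m + 1) (n + 1) (r + 1) :=
  ⟨(fun i => (s.1.1 i).succ, fun j => (s.1.2 j).succ), by
    refine ⟨fun i j hij => Fin.succ_lt_succ_iff.2 (s.2.left hij),
      fun i j hij => Fin.succ_lt_succ_iff.2 (s.2.right hij), fun i j => ?_, fun l => ?_⟩
    · simpa using s.2.disjoint i j
    · intro hp hq
      induction l using Fin.cases with
      | zero => exact ⟨⟨0, Fin.succ_pos _⟩, 0, Fin.succ_pos _⟩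
      | succ l =>
        obtain ⟨⟨i, hi⟩, j, hj⟩ := s.2.inserted l
          (fun i h => hp i (by simp [h])) (fun j h => hq j (by simp [h]))
        exact ⟨⟨i, by simpa using hi⟩, j, by simpa using hj⟩⟩

theorem consLeft_injective (m n r : ℕ) :
    Function.Injective (consLeft (m := m) (n := n) (r := r)) := by
  rintro ⟨⟨p, q⟩, h⟩ ⟨⟨p', q'⟩, h'⟩ e
  simp only [consLeft, Subtype.mk.injEq, Prod.mk.injEq, funext_iff, Fin.succ_inj] at e
  simp only [Subtype.mk.injEq, Prod.mk.injEq, funext_iff]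
  exact ⟨fun i => by simpa using e.1 i.succ, e.2⟩

theorem swap_injective (m n r : ℕ) : Function.Injective (swap (m := m) (n := n) (r := r)) :=
  Function.LeftInverse.injective swap_swap

theorem consRight_injective (m n r : ℕ) :
    Function.Injective (consRight (m := m) (n := n) (r := r)) :=
  (swap_injective _ _ _).comp ((consLeft_injective _ _ _).comp (swap_injective _ _ _))

theorem consInserted_injective (m n r : ℕ) :
    Function.Injective (consInserted (m := m) (n := n) (r := r)) := by
  rintro ⟨⟨p, q⟩, h⟩ ⟨⟨p', q'⟩, h'⟩ e
  simp only [consInserted, Subtype.mk.injEq, Prod.mk.injEq, funext_iff, Fin.succ_inj] at e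
  simp only [Subtype.mk.injEq, Prod.mk.injEq, funext_iff]
  exact e

theorem exists_consLeft {m n r : ℕ} (s : ExtendedShuffle (m + 1) n (r + 1)) (h : s.1.1 0 = 0) :
    ∃ t, consLeft t = s := by
  obtain ⟨⟨p, q⟩, hs⟩ := s
  dsimp only at h hs
  have hp : ∀ i : Fin m, p i.succ ≠ 0 := fun i hi =>
    (Fin.succ_ne_zero i) (hs.left.injective (hi.trans h.symm))
  have hq : ∀ j, q j ≠ 0 := fun j hj => hs.disjoint 0 j (h.trans hj.symm)
  refine ⟨⟨(fun i => (p i.succ).pred (hp i), fun j => (q j).pred (hq j)), ?_, ?_, ?_, ?_⟩, ?_⟩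
  · exact fun i j hij => (Fin.pred_lt_pred_iff (ha := hp _) (hb := hp _)).2
      (hs.left (Fin.succ_lt_succ_iff.2 hij))
  · exact fun i j hij => (Fin.pred_lt_pred_iff (ha := hq _) (hb := hq _)).2 (hs.right hij)
  · exact fun i j hij => hs.disjoint i.succ j ((Fin.pred_inj (ha := hp _) (hb := hq _)).1 hij)
  · intro l hl1 hl2
    obtain ⟨⟨i, hi⟩, j, hj⟩ := hs.inserted l.succ
      (fun i => by
        induction i using Fin.cases with
        | zero =>
          rw [h]
          exact (Fin.succ_ne_zero l).symm
        | succ i => exact fun e => hl1 i (by simp [e]))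
      (fun j e => hl2 j (by simp [e]))
    refine ⟨?_, j, by simpa [Fin.lt_pred_iff] using hj⟩
    -- The letter to the right of `l.succ` cannot be the removed one, which sits at position `0`.
    induction i using Fin.cases with
    | zero =>
      rw [h] at hi
      exact absurd hi (Fin.not_lt_zero _)
    | succ i => exact ⟨i, by simpa [Fin.lt_pred_iff] using hi⟩
  · refine Subtype.ext (Prod.ext (funext fun i => ?_) (funext fun j => ?_))
    · induction i using Fin.cases with
      | zero => simp [consLeft, h]
      | succ i => simp [consLeft]
    · simp [consLeft]

theorem exists_consRight {m n r : ℕ} (s : ExtendedShuffle m (n + 1) (r + 1)) (h : s.1.2 0 = 0) :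
    ∃ t, consRight t = s := by
  obtain ⟨t, ht⟩ := exists_consLeft s.swap h
  exact ⟨t.swap, by rw [consRight, swap_swap, ht, swap_swap]⟩

theorem exists_consInserted {m n r : ℕ} (s : ExtendedShuffle (m + 1) (n + 1) (r + 1))
    (h : s.1.1 0 ≠ 0) (h' : s.1.2 0 ≠ 0) : ∃ t, consInserted t = s := by
  obtain ⟨⟨p, q⟩, hs⟩ := s
  dsimp only at h h' hs
  have hp : ∀ i, p i ≠ 0 := fun i hi => h (Fin.le_zero_iff.1
    ((hs.left.monotone (Fin.zero_le i)).trans hi.le))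
  have hq : ∀ i, q i ≠ 0 := fun i hi => h' (Fin.le_zero_iff.1
    ((hs.right.monotone (Fin.zero_le i)).trans hi.le))
  refine ⟨⟨(fun i => (p i).pred (hp i), fun j => (q j).pred (hq j)), ?_, ?_, ?_, ?_⟩, ?_⟩
  · exact fun i j hij => (Fin.pred_lt_pred_iff (ha := hp _) (hb := hp _)).2 (hs.left hij)
  · exact fun i j hij => (Fin.pred_lt_pred_iff (ha := hq _) (hb := hq _)).2 (hs.right hij)
  · exact fun i j hij => hs.disjoint i j ((Fin.pred_inj (ha := hp _) (hb := hq _)).1 hij)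
  · intro l hl1 hl2
    obtain ⟨⟨i, hi⟩, j, hj⟩ := hs.inserted l.succ (fun i e => hl1 i (by simp [e]))
      (fun j e => hl2 j (by simp [e]))
    exact ⟨⟨i, by simpa [Fin.lt_pred_iff] using hi⟩, j, by simpa [Fin.lt_pred_iff] using hj⟩
  · simp [consInserted]

/-- An inserted letter must precede some letter of the second word, so an empty second word forbids
insertions. -/
theorem left_zero_of_right_empty {m r : ℕ} (s : ExtendedShuffle (m + 1) 0 (r + 1)) :
    s.1.1 0 = 0 := by
  by_contra h
  have hp : ∀ i, s.1.1 i ≠ 0 := fun i hi => h (Fin.le_zero_iff.1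
    ((s.2.left.monotone (Fin.zero_le i)).trans hi.le))
  obtain ⟨-, j, -⟩ := s.2.inserted 0 hp (fun j => j.elim0)
  exact j.elim0

theorem card_zero_zero_zero : Nat.card (ExtendedShuffle 0 0 0) = 1 := by
  rw [Nat.card_eq_one_iff_unique]
  refine ⟨⟨fun s t => Subtype.ext (Subsingleton.elim _ _)⟩, ⟨⟨(Fin.elim0, Fin.elim0), ?_⟩⟩⟩
  exact ⟨fun i => i.elim0, fun i => i.elim0, fun i => i.elim0, fun i => i.elim0⟩

theorem card_zero_zero_succ (r : ℕ) : Nat.card (ExtendedShuffle 0 0 (r + 1)) = 0 := by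
  have : IsEmpty (ExtendedShuffle 0 0 (r + 1)) := ⟨fun s => by
    obtain ⟨⟨i, -⟩, -⟩ := s.2.inserted 0 (fun i => i.elim0) (fun i => i.elim0)
    exact i.elim0⟩
  exact Nat.card_of_isEmpty

theorem card_eq_zero_of_lt {m n r : ℕ} (h : r < m + n) : Nat.card (ExtendedShuffle m n r) = 0 := by
  have : IsEmpty (ExtendedShuffle m n r) := ⟨fun s => by
    have hi : Function.Injective (Sum.elim s.1.1 s.1.2) :=
      s.2.left.injective.sumElim s.2.right.injective s.2.disjoint
    have := Fintype.card_le_of_injective _ hi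
    simp at this
    omega⟩
  exact Nat.card_of_isEmpty

theorem card_succ_zero_succ (m r : ℕ) :
    Nat.card (ExtendedShuffle (m + 1) 0 (r + 1)) = Nat.card (ExtendedShuffle m 0 r) :=
  (Nat.card_congr (Equiv.ofBijective consLeft ⟨consLeft_injective _ _ _,
    fun s => exists_consLeft s (left_zero_of_right_empty s)⟩)).symm

theorem card_zero_succ_succ (n r : ℕ) :
    Nat.card (ExtendedShuffle 0 (n + 1) (r + 1)) = Nat.card (ExtendedShuffle 0 n r) := by
  rw [card_swap, card_succ_zero_succ, card_swap]

/-- Position `0` holds the first letter of the first word, that of the second word, or an inserted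
letter; deleting it leaves an extended shuffle of length `r`. -/
theorem card_succ_succ_succ (m n r : ℕ) :
    Nat.card (ExtendedShuffle (m + 1) (n + 1) (r + 1)) =
      Nat.card (ExtendedShuffle m (n + 1) r) + Nat.card (ExtendedShuffle (m + 1) n r) +
        Nat.card (ExtendedShuffle (m + 1) (n + 1) r) := by
  rw [← Nat.card_sum, ← Nat.card_sum]
  refine (Nat.card_congr (Equiv.ofBijective
    (Sum.elim (Sum.elim consLeft consRight) consInserted) ⟨?_, fun s => ?_⟩)).symm
  · refine ((consLeft_injective _ _ _).sumElim (consRight_injective _ _ _) ?_).sumElim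
      (consInserted_injective _ _ _) ?_
    · intro s t e
      have := congrFun (congrArg (fun s => s.1.1) e) 0
      exact (Fin.succ_ne_zero _) this.symm
    · rintro (s | s) t e
      · have := congrFun (congrArg (fun s => s.1.1) e) 0
        exact (Fin.succ_ne_zero _) this.symm
      · have := congrFun (congrArg (fun s => s.1.2) e) 0
        exact (Fin.succ_ne_zero _) this.symm
  · by_cases h : s.1.1 0 = 0
    · obtain ⟨t, rfl⟩ := exists_consLeft s h
      exact ⟨Sum.inl (Sum.inl t), rfl⟩
    by_cases h' : s.1.2 0 = 0
    · obtain ⟨t, rfl⟩ := exists_consRight s h'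
      exact ⟨Sum.inl (Sum.inr t), rfl⟩
    obtain ⟨t, rfl⟩ := exists_consInserted s h h'
    exact ⟨Sum.inr t, rfl⟩

/-- The two words occupy `m + n` distinct positions with ones; each remaining position contributes
`c`. -/
theorem prod_shuffleWord_one {A : Type*} [CommRing A] {m n r : ℕ} (s : ExtendedShuffle m n r)
    (c : A) : ∏ l, shuffleWord s.1.1 s.1.2 c (fun _ => 1) (fun _ => 1) l = c ^ (r - (m + n)) := by
  classical
  set t := Finset.univ.image (Sum.elim s.1.1 s.1.2)
  have ht : ∀ l, l ∈ t ↔ (∃ i, s.1.1 i = l) ∨ ∃ j, s.1.2 j = l := by simp [t]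
  have hc : t.card = m + n := by
    rw [Finset.card_image_of_injective _
      (s.2.left.injective.sumElim s.2.right.injective s.2.disjoint)]
    simp
  have h1 : ∀ l, shuffleWord s.1.1 s.1.2 c (fun _ => 1) (fun _ => 1) l
      = if l ∈ tᶜ then c else 1 := by
    intro l
    simp only [shuffleWord, Finset.mem_compl, ht]
    split_ifs <;> simp_all
  simp only [h1]
  rw [Finset.prod_ite_mem, Finset.univ_inter, Finset.prod_const, Finset.card_compl, hc,
    Fintype.card_fin]

end ExtendedShuffle

/-- The coefficient of the word of `r` ones in the complete shuffle product, for the inserted letter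
`c`, of the words of `m` and `n` ones. -/
noncomputable def shuffleCoeff (c : ℝ) (m n r : ℕ) : ℝ :=
  Nat.card (ExtendedShuffle m n r) * c ^ (r - (m + n))

open ExtendedShuffle in
theorem shuffleCoeff_zero_zero_zero (c : ℝ) : shuffleCoeff c 0 0 0 = 1 := by
  simp [shuffleCoeff, card_zero_zero_zero]

open ExtendedShuffle in
theorem shuffleCoeff_zero_zero_succ (c : ℝ) (r : ℕ) : shuffleCoeff c 0 0 (r + 1) = 0 := by
  simp [shuffleCoeff, card_zero_zero_succ]

theorem shuffleCoeff_eq_zero (c : ℝ) {m n r : ℕ} (h : r < m + n) : shuffleCoeff c m n r = 0 := by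
  simp [shuffleCoeff, ExtendedShuffle.card_eq_zero_of_lt h]

theorem shuffleCoeff_succ_zero_succ (c : ℝ) (m r : ℕ) :
    shuffleCoeff c (m + 1) 0 (r + 1) = shuffleCoeff c m 0 r := by
  rw [shuffleCoeff, shuffleCoeff, ExtendedShuffle.card_succ_zero_succ]
  congr 2
  omega

theorem shuffleCoeff_zero_succ_succ (c : ℝ) (n r : ℕ) :
    shuffleCoeff c 0 (n + 1) (r + 1) = shuffleCoeff c 0 n r := by
  rw [shuffleCoeff, shuffleCoeff, ExtendedShuffle.card_zero_succ_succ]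
  congr 2
  omega

theorem shuffleCoeff_succ_succ_succ (c : ℝ) (m n r : ℕ) :
    shuffleCoeff c (m + 1) (n + 1) (r + 1) = shuffleCoeff c m (n + 1) r +
      shuffleCoeff c (m + 1) n r + c * shuffleCoeff c (m + 1) (n + 1) r := by
  have h1 : r + 1 - (m + 1 + (n + 1)) = r - (m + (n + 1)) := by omega
  have h2 : r - (m + 1 + n) = r - (m + (n + 1)) := by omega
  rw [shuffleCoeff, shuffleCoeff, shuffleCoeff, h1, h2, ExtendedShuffle.card_succ_succ_succ]
  -- Below this length the exponent of `c` in the last term is truncated at zero, but its count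
  -- vanishes.
  rcases lt_or_ge r (m + 1 + (n + 1)) with h | h
  · rw [shuffleCoeff_eq_zero c h, ExtendedShuffle.card_eq_zero_of_lt h]
    push_cast
    ring
  · have h3 : r - (m + (n + 1)) = r - (m + 1 + (n + 1)) + 1 := by omega
    rw [shuffleCoeff, h3]
    push_cast
    ring

/-! ### The expansion of a product -/

namespace IsVolterraPair

variable {w : ℝ} {D P : ℝ⟦X⟧ →ₗ[ℝ] ℝ⟦X⟧}

/-- The three terms mirror the three possible first letters of an extended shuffle. Removing
constant terms in the last matches the rule that an insertion needs both words nonempty. -/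
theorem tail_mul (H : IsVolterraPair w D P) (f g : ℝ⟦X⟧) :
    volterraTail D (f * g) = volterraTail D f * g + f * volterraTail D g
      - w • ((f - PowerSeries.coeff 0 f • 1) * (g - PowerSeries.coeff 0 g • 1)) := by
  have hf := H.D_eq f
  have hg := H.D_eq g
  have hfg := H.D_eq (f * g)
  have h0 : PowerSeries.coeff 0 (f * g) = PowerSeries.coeff 0 f * PowerSeries.coeff 0 g := by
    simp
  rw [H.D_mul, hf, hg, h0] at hfg
  simp only [PowerSeries.smul_eq_C_mul, map_mul] at hfg ⊢
  linear_combination -hfg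

/-- The coefficients of a product, in terms of those of the factors. -/
theorem coeff_mul (H : IsVolterraPair w D P) (r : ℕ) (f g : ℝ⟦X⟧) (M N : ℕ) (hM : r < M)
    (hN : r < N) :
    volterraCoeff D r (f * g) = ∑ m ∈ Finset.range M, ∑ n ∈ Finset.range N,
      shuffleCoeff (-w) m n r * (volterraCoeff D m f * volterraCoeff D n g) := by
  induction r generalizing f g M N with
  | zero =>
    obtain ⟨M, rfl⟩ := Nat.exists_eq_succ_of_ne_zero hM.ne'
    obtain ⟨N, rfl⟩ := Nat.exists_eq_succ_of_ne_zero hN.ne'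
    simp only [Nat.succ_eq_add_one, Finset.sum_range_succ', shuffleCoeff_zero_zero_zero,
      volterraCoeff_zero]
    have h1 : ∀ m n, shuffleCoeff (-w) (m + 1) n 0 = 0 := fun m n =>
      shuffleCoeff_eq_zero _ (by omega)
    have h2 : ∀ m n, shuffleCoeff (-w) m (n + 1) 0 = 0 := fun m n =>
      shuffleCoeff_eq_zero _ (by omega)
    simp [h1, h2]
  | succ r ih =>
    obtain ⟨M, rfl⟩ := Nat.exists_eq_succ_of_ne_zero (Nat.ne_zero_of_lt hM)
    obtain ⟨N, rfl⟩ := Nat.exists_eq_succ_of_ne_zero (Nat.ne_zero_of_lt hN)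
    rw [Nat.succ_eq_add_one] at *
    have e0 : ∀ f : ℝ⟦X⟧, volterraCoeff D 0 (f - PowerSeries.coeff 0 f • 1) = 0 := fun f => by
      simp [volterraCoeff_zero]
    have e1 : ∀ (f : ℝ⟦X⟧) (m : ℕ),
        volterraCoeff D (m + 1) (f - PowerSeries.coeff 0 f • 1) = volterraCoeff D (m + 1) f :=
      fun f m => by rw [map_sub, map_smul, coeff_one_succ, smul_zero, sub_zero]
    -- Taking the tail of a factor shifts its index by one, hence the three different pairs of
    -- cutoffs; this is why `M` and `N` are independent of `r`.
    rw [volterraCoeff_succ, H.tail_mul, map_sub, map_add, map_smul,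
      ih (volterraTail D f) g M (N + 1) (by omega) (by omega),
      ih f (volterraTail D g) (M + 1) N (by omega) (by omega),
      ih _ _ (M + 1) (N + 1) (by omega) (by omega)]
    simp only [← volterraCoeff_succ, Finset.sum_range_succ', e0, e1, shuffleCoeff_succ_succ_succ,
      shuffleCoeff_succ_zero_succ, shuffleCoeff_zero_succ_succ, shuffleCoeff_zero_zero_succ,
      mul_zero, zero_mul, add_zero, Finset.sum_const_zero, add_mul, Finset.sum_add_distrib,
      smul_eq_mul, neg_mul, Finset.sum_neg_distrib, Finset.mul_sum, mul_assoc]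
    ring

end IsVolterraPair

/-! ### The complete shuffle algebra over the ground field -/

/-- A power series in the powers `Pⁿ(1)` is determined by its coefficients, which are arbitrary. -/
noncomputable def IsVolterraPair.coeffEquiv {w : ℝ} {D P : ℝ⟦X⟧ →ₗ[ℝ] ℝ⟦X⟧}
    (H : IsVolterraPair w D P) : ℝ⟦X⟧ ≃ₗ[ℝ] (ℕ → ℝ) :=
  LinearEquiv.ofBijective (LinearMap.pi (volterraCoeff D)) (by
    constructor
    · refine (injective_iff_map_eq_zero _).2 fun f hf => ?_
      exact isCompleteFiltration_xAdic.eq_zero fun n =>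
        H.mem_xAdic_iff_coeff.2 fun k _ => congrFun hf k
    · intro c
      obtain ⟨f, hf⟩ := isCompleteFiltration_xAdic.exists_limit
        (fun n => ∑ j ∈ Finset.range n, c j • (P ^ j) 1) (by
          intro m n hmn
          rw [← Finset.sum_range_add_sum_Ico _ hmn, add_sub_cancel_left]
          refine (xAdic m).sum_mem fun j hj => (xAdic m).smul_mem _ ?_
          refine H.mem_xAdic_iff_coeff.2 fun k hk => ?_
          rw [H.coeff_P_pow, if_neg]
          exact (hk.trans_le (Finset.mem_Ico.1 hj).1).ne)
      refine ⟨f, funext fun k => ?_⟩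
      -- The partial sum of length `k + 1` is the first to contain the `k`-th term.
      have h := H.mem_xAdic_iff_coeff.1 (hf (k + 1)) k k.lt_succ_self
      rw [map_sub, sub_eq_zero] at h
      simp [LinearMap.pi_apply, h, H.coeff_P_pow])

theorem IsVolterraPair.coeffEquiv_apply {w : ℝ} {D P : ℝ⟦X⟧ →ₗ[ℝ] ℝ⟦X⟧}
    (H : IsVolterraPair w D P) (f : ℝ⟦X⟧) (n : ℕ) : H.coeffEquiv f n = volterraCoeff D n f := rfl

/-- The tensor powers of the ground field are one-dimensional. -/
noncomputable def tensorPowerSelfEquiv (n : ℕ) : (⨂[ℝ]^n ℝ) ≃ₗ[ℝ] ℝ :=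
  (PiTensorProduct.constantBaseRingEquiv (Fin n) ℝ).toLinearEquiv

theorem tensorPowerSelfEquiv_tprod {n : ℕ} (a : Fin n → ℝ) :
    tensorPowerSelfEquiv n (PiTensorProduct.tprod ℝ a) = ∏ i, a i :=
  PiTensorProduct.constantBaseRingEquiv_tprod a

/-- Reduces every structure map of the shuffle algebra to its value on words of ones. -/
theorem eq_smul_tprod_one {n : ℕ} (x : ⨂[ℝ]^n ℝ) :
    x = tensorPowerSelfEquiv n x • PiTensorProduct.tprod ℝ (fun _ : Fin n => (1 : ℝ)) := by
  apply (tensorPowerSelfEquiv n).injective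
  rw [map_smul, tensorPowerSelfEquiv_tprod]
  simp

open Classical in
theorem tensorPowerSelfEquiv_completeShuffle (c : ℝ) (m n r : ℕ) :
    tensorPowerSelfEquiv r (completeShuffle ℝ c m n r
      (PiTensorProduct.tprod ℝ fun _ => 1) (PiTensorProduct.tprod ℝ fun _ => 1))
      = shuffleCoeff (-c) m n r := by
  rw [completeShuffle_tprod, map_sum]
  simp only [tensorPowerSelfEquiv_tprod, ExtendedShuffle.prod_shuffleWord_one]
  rw [Finset.sum_const, Finset.card_univ, shuffleCoeff, Nat.card_eq_fintype_card, nsmul_eq_mul]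

theorem tensorPowerSelfEquiv_joinHead {k : ℕ} (a : ℝ) (x : ⨂[ℝ]^k ℝ) :
    tensorPowerSelfEquiv (k + 1) (joinHead ℝ k (a ⊗ₜ[ℝ] x)) = a * tensorPowerSelfEquiv k x := by
  conv_lhs => rw [eq_smul_tprod_one x]
  rw [TensorProduct.tmul_smul, map_smul, map_smul, joinHead_tmul_tprod, tensorPowerSelfEquiv_tprod,
    Fin.prod_univ_succ]
  simp [mul_comm]

theorem splitHead_eq {k : ℕ} (x : ⨂[ℝ]^(k + 1) ℝ) :
    splitHead ℝ k x = tensorPowerSelfEquiv (k + 1) x •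
      ((1 : ℝ) ⊗ₜ[ℝ] PiTensorProduct.tprod ℝ (fun _ : Fin k => (1 : ℝ))) := by
  conv_lhs => rw [eq_smul_tprod_one x]
  rw [map_smul, splitHead_tprod]

namespace Shai

theorem tensorPowerSelfEquiv_mul (c : ℝ) (x y : Shai ℝ ℝ) (r : ℕ) :
    tensorPowerSelfEquiv (r + 1) (mul c x y r) =
      ∑ m ∈ Finset.range (r + 1), ∑ n ∈ Finset.range (r + 1), shuffleCoeff (-c) m n r *
        (tensorPowerSelfEquiv (m + 1) (x m) * tensorPowerSelfEquiv (n + 1) (y n)) := by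
  simp only [mul, map_sum]
  refine Finset.sum_congr rfl fun m _ => Finset.sum_congr rfl fun n _ => ?_
  rw [splitHead_eq, splitHead_eq]
  simp only [map_smul, LinearMap.smul_apply, TensorProduct.map₂_apply_tmul, TensorProduct.map_tmul,
    tensorPowerSelfEquiv_joinHead, tensorPowerSelfEquiv_completeShuffle, LinearMap.mul_apply',
    smul_eq_mul]
  ring

theorem tensorPowerSelfEquiv_mapHead (f : ℝ →ₗ[ℝ] ℝ) (k : ℕ) (x : ⨂[ℝ]^(k + 1) ℝ) :
    tensorPowerSelfEquiv (k + 1) (mapHead f k x) = f 1 * tensorPowerSelfEquiv (k + 1) x := by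
  simp only [mapHead, LinearMap.comp_apply]
  rw [splitHead_eq]
  simp only [map_smul, LinearMap.rTensor_tmul, tensorPowerSelfEquiv_joinHead,
    tensorPowerSelfEquiv_tprod, smul_eq_mul]
  simp [mul_comm]

theorem tensorPowerSelfEquiv_mergeHead (k : ℕ) (x : ⨂[ℝ]^(k + 2) ℝ) :
    tensorPowerSelfEquiv (k + 1) (mergeHead k x) = tensorPowerSelfEquiv (k + 2) x := by
  simp only [mergeHead, LinearMap.comp_apply]
  rw [splitHead_eq]
  simp only [map_smul, LinearMap.lTensor_tmul, splitHead_tprod, LinearEquiv.coe_coe,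
    TensorProduct.assoc_symm_tmul, LinearMap.rTensor_tmul, tensorPowerSelfEquiv_joinHead,
    tensorPowerSelfEquiv_tprod, LinearMap.mul'_apply, smul_eq_mul]
  simp

end Shai

namespace IsVolterraPair

variable {w : ℝ} {D P : ℝ⟦X⟧ →ₗ[ℝ] ℝ⟦X⟧}

/-- The map sending `1^{⊗ (n + 1)}` to `Pⁿ(1)`. -/
noncomputable def shaiEquiv (H : IsVolterraPair w D P) : Shai ℝ ℝ ≃ₗ[ℝ] ℝ⟦X⟧ :=
  (LinearEquiv.piCongrRight fun k => tensorPowerSelfEquiv (k + 1)) ≪≫ₗ H.coeffEquiv.symm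

theorem coeff_shaiEquiv (H : IsVolterraPair w D P) (x : Shai ℝ ℝ) (n : ℕ) :
    volterraCoeff D n (H.shaiEquiv x) = tensorPowerSelfEquiv (n + 1) (x n) := by
  rw [← H.coeffEquiv_apply]
  simp [shaiEquiv]

theorem ext_coeff (H : IsVolterraPair w D P) {f g : ℝ⟦X⟧}
    (h : ∀ n, volterraCoeff D n f = volterraCoeff D n g) : f = g :=
  H.coeffEquiv.injective (funext h)

theorem shaiEquiv_pure_one (H : IsVolterraPair w D P) (n : ℕ) :
    H.shaiEquiv (Shai.pure fun _ : Fin (n + 1) => (1 : ℝ)) = (P ^ n) 1 := by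
  refine H.ext_coeff fun m => ?_
  rw [H.coeff_shaiEquiv, H.coeff_P_pow, Shai.pure]
  split_ifs with h
  · subst h
    rw [Pi.single_eq_same, tensorPowerSelfEquiv_tprod]
    simp
  · rw [Pi.single_eq_of_ne h, map_zero]

theorem isIso_shaiEquiv (H : IsVolterraPair w D P) :
    Shai.IsIso (w • (LinearMap.id : ℝ →ₗ[ℝ] ℝ)) xAdic D P H.shaiEquiv where
  map_mul x y := by
    refine H.ext_coeff fun r => ?_
    rw [H.coeff_shaiEquiv, H.coeff_mul r _ _ (r + 1) (r + 1) r.lt_succ_self r.lt_succ_self,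
      Shai.tensorPowerSelfEquiv_mul]
    simp only [H.coeff_shaiEquiv, LinearMap.smul_apply, LinearMap.id_apply, smul_eq_mul, mul_one]
  map_incl a := by
    have h : (Shai.incl a : Shai ℝ ℝ) = a • Shai.pure fun _ : Fin 1 => (1 : ℝ) := by
      rw [Shai.incl, Shai.pure, Shai.pure, ← Pi.single_smul,
        eq_smul_tprod_one (PiTensorProduct.tprod ℝ fun _ => a), tensorPowerSelfEquiv_tprod]
      simp
    rw [h, map_smul, H.shaiEquiv_pure_one, Algebra.algebraMap_eq_smul_one]
    rfl
  map_D x := by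
    refine H.ext_coeff fun r => ?_
    rw [H.coeff_shaiEquiv, H.D_eq, map_add, map_smul, ← volterraCoeff_succ, H.coeff_shaiEquiv,
      ← volterraCoeff_zero D, H.coeff_shaiEquiv]
    -- In degree `1` the term `d(1) = w` survives; in higher degrees it cancels against the
    -- subtracted multiplication by `d(1)`, leaving a pure shift.
    cases r with
    | zero =>
      rw [Shai.D, map_add, Shai.tensorPowerSelfEquiv_mapHead, Shai.tensorPowerSelfEquiv_mergeHead,
        coeff_one_zero]
      simp
    | succ r =>
      rw [Shai.D, map_sub, map_add, Shai.tensorPowerSelfEquiv_mapHead,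
        Shai.tensorPowerSelfEquiv_mapHead, Shai.tensorPowerSelfEquiv_mergeHead, coeff_one_succ]
      simp
  map_P x := by
    refine H.ext_coeff fun r => ?_
    rw [H.coeff_shaiEquiv]
    cases r with
    | zero => rw [Shai.P, map_zero, H.coeff_P_zero]
    | succ r =>
      rw [Shai.P, tensorPowerSelfEquiv_joinHead, one_mul, H.coeff_P_succ, H.coeff_shaiEquiv]
  map_filtration n x := by
    rw [H.mem_xAdic_iff_coeff]
    refine forall₂_congr fun k _ => ?_
    rw [H.coeff_shaiEquiv, LinearEquiv.map_eq_zero_iff]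

end IsVolterraPair

/-! ### Truncated exponential series -/

/-- The series `∑_{s ≥ n} Xˢ / s!`. -/
noncomputable def expFrom (n : ℕ) : ℝ⟦X⟧ :=
  PowerSeries.mk fun s => if n ≤ s then ((s.factorial : ℝ))⁻¹ else 0

theorem derivative_expFrom_zero : PowerSeries.derivative ℝ (expFrom 0) = expFrom 0 := by
  ext n
  rw [PowerSeries.coeff_derivative]
  simp only [expFrom, PowerSeries.coeff_mk, Nat.zero_le, if_true, Nat.factorial_succ, Nat.cast_mul,
    mul_inv, Nat.cast_succ]
  have : (n : ℝ) + 1 ≠ 0 := by positivity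
  field_simp

theorem derivative_expFrom_succ (n : ℕ) :
    PowerSeries.derivative ℝ (expFrom (n + 1)) = expFrom n := by
  ext s
  rw [PowerSeries.coeff_derivative]
  simp only [expFrom, PowerSeries.coeff_mk, Nat.add_le_add_iff_right, Nat.factorial_succ,
    Nat.cast_mul, mul_inv, Nat.cast_succ]
  have : (s : ℝ) + 1 ≠ 0 := by positivity
  split_ifs
  · field_simp
  · rw [zero_mul]

theorem constantCoeff_expFrom_succ (n : ℕ) : PowerSeries.constantCoeff (expFrom (n + 1)) = 0 := by
  rw [← PowerSeries.coeff_zero_eq_constantCoeff_apply, expFrom, PowerSeries.coeff_mk]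
  simp

theorem coeff_pow_eq_zero {L : ℝ⟦X⟧} (hL : PowerSeries.constantCoeff L = 0) {s m : ℕ} (h : m < s) :
    PowerSeries.coeff m (L ^ s) = 0 := by
  have h1 : (PowerSeries.X : ℝ⟦X⟧) ^ s ∣ L ^ s := pow_dvd_pow_of_dvd (PowerSeries.X_dvd_iff.2 hL) s
  exact PowerSeries.X_pow_dvd_iff.1 h1 m h

theorem coeff_subst_expFrom {L : ℝ⟦X⟧} (hL : PowerSeries.constantCoeff L = 0) (n m N : ℕ)
    (h : m < N) : PowerSeries.coeff m ((expFrom n).subst L) =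
      ∑ s ∈ Finset.range N, PowerSeries.coeff s (expFrom n) * PowerSeries.coeff m (L ^ s) := by
  rw [PowerSeries.coeff_subst' (PowerSeries.HasSubst.of_constantCoeff_zero' hL)]
  simp only [smul_eq_mul]
  refine finsum_eq_sum_of_support_subset _ fun s hs => ?_
  simp only [Finset.coe_range, Set.mem_Iio]
  by_contra hN
  refine hs ?_
  simp only
  rw [coeff_pow_eq_zero hL (by omega), mul_zero]

theorem hasSum_subst_expFrom {L : ℝ⟦X⟧} (hL : PowerSeries.constantCoeff L = 0) (n : ℕ) :
    @HasSum ℝ⟦X⟧ (Set.Ici n) _ (filtrationTopology xAdic)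
      (fun s => ((s : ℕ).factorial : ℝ)⁻¹ • L ^ (s : ℕ)) ((expFrom n).subst L)
      (SummationFilter.unconditional _) := by
  let _ := filtrationTopology xAdic
  rw [HasSum, SummationFilter.unconditional_filter]
  refine TopologicalSpace.tendsto_nhds_generateFrom_iff.2 ?_
  rintro U ⟨x, N, rfl⟩ hU
  -- Since `L` has no constant term, `L ^ s` vanishes modulo `x ^ N` for `s ≥ N`; only these indices
  -- matter.
  let t₀ : Finset (Set.Ici n) := (Finset.range N).subtype (fun s => s ∈ Set.Ici n)
  filter_upwards [Filter.eventually_ge_atTop t₀] with t ht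
  have key : ∑ s ∈ t, ((s : ℕ).factorial : ℝ)⁻¹ • L ^ (s : ℕ) - (expFrom n).subst L ∈ xAdic N := by
    refine mem_xAdic_iff.2 fun m hm => ?_
    rw [map_sub, coeff_subst_expFrom hL n m N hm, map_sum, sub_eq_zero]
    rw [← Finset.sum_subset ht]
    · have h1 := Finset.sum_subtype_eq_sum_filter (s := Finset.range N)
        (p := fun s => s ∈ Set.Ici n) (fun s => PowerSeries.coeff m ((s.factorial : ℝ)⁻¹ • L ^ s))
      refine h1.trans ?_
      rw [Finset.sum_filter]
      refine Finset.sum_congr rfl fun s _ => ?_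
      simp only [expFrom, PowerSeries.coeff_mk, Set.mem_Ici, map_smul, smul_eq_mul]
      split_ifs <;> simp
    · intro s _ hs
      have h1 : m < (s : ℕ) := by
        by_contra h2
        exact hs (Finset.mem_subtype.2 (Finset.mem_range.2 (by omega)))
      rw [map_smul, coeff_pow_eq_zero hL h1, smul_zero]
  have := (xAdic N).add_mem key hU
  simpa using this

/-! ### Logarithms and the closed form of `Pⁿ(1)`. -/

theorem mul_derivative_logOf {v : ℝ⟦X⟧} (hv : PowerSeries.constantCoeff v = 1) :
    v * PowerSeries.derivative ℝ (PowerSeries.logOf v) = PowerSeries.derivative ℝ v := by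
  have h : PowerSeries.HasSubst (v - 1) :=
    PowerSeries.HasSubst.of_constantCoeff_zero' (by simp [hv])
  have h1 : (1 + PowerSeries.X : ℝ⟦X⟧) * PowerSeries.derivative ℝ (PowerSeries.log ℝ) = 1 := by
    ext n
    rw [PowerSeries.deriv_log, add_mul, one_mul, map_add]
    cases n with
    | zero => simp
    | succ n =>
      rw [PowerSeries.coeff_succ_X_mul, PowerSeries.coeff_one, if_neg n.succ_ne_zero]
      simp [pow_succ]
  have h2 := congrArg (PowerSeries.subst (v - 1)) h1
  rw [← PowerSeries.coe_substAlgHom h, map_mul, map_add, map_one, PowerSeries.coe_substAlgHom h,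
    PowerSeries.subst_X h, add_sub_cancel] at h2
  rw [PowerSeries.logOf_eq, PowerSeries.derivative_subst h, ← mul_assoc, h2, map_sub,
    Derivation.map_one_eq_zero, sub_zero, one_mul]

theorem constantCoeff_subst_expFrom {L : ℝ⟦X⟧} (hL : PowerSeries.constantCoeff L = 0) (n : ℕ) :
    PowerSeries.constantCoeff ((expFrom n).subst L) = PowerSeries.constantCoeff (expFrom n) := by
  rw [← PowerSeries.coeff_zero_eq_constantCoeff_apply, coeff_subst_expFrom hL n 0 1 one_pos]
  simp

/-- With `E` the left side, `v E' = E v'`; hence `E / v` has zero derivative and constant term `1`.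
-/
theorem subst_logOf_expFrom_zero {v : ℝ⟦X⟧} (hv : PowerSeries.constantCoeff v = 1) :
    (expFrom 0).subst (PowerSeries.logOf v) = v := by
  have hL := PowerSeries.constantCoeff_logOf hv
  have hs : PowerSeries.HasSubst (PowerSeries.logOf v) :=
    PowerSeries.HasSubst.of_constantCoeff_zero' hL
  have hv0 : PowerSeries.constantCoeff v ≠ 0 := by rw [hv]; exact one_ne_zero
  have hi : v * v⁻¹ = 1 := PowerSeries.mul_inv_cancel v hv0
  set E := (expFrom 0).subst (PowerSeries.logOf v) with hE
  have hd : v * PowerSeries.derivative ℝ E = E * PowerSeries.derivative ℝ v := by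
    rw [hE, PowerSeries.derivative_subst hs, derivative_expFrom_zero, mul_left_comm,
      mul_derivative_logOf hv]
  have hq : E * v⁻¹ = 1 := by
    apply PowerSeries.derivative.ext
    · rw [Derivation.leibniz, PowerSeries.derivative_inv', Derivation.map_one_eq_zero, smul_eq_mul,
        smul_eq_mul]
      linear_combination (v⁻¹ ^ 2) * hd - (v⁻¹ * PowerSeries.derivative ℝ E) * hi
    · rw [map_mul, hE, constantCoeff_subst_expFrom hL, PowerSeries.constantCoeff_inv, hv, map_one,
        ← PowerSeries.coeff_zero_eq_constantCoeff_apply, expFrom, PowerSeries.coeff_mk]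
      simp
  linear_combination v * hq - E * hi

theorem volterraP_pow_one {k h : ℝ⟦X⟧} {μ : ℝ} (hk₀ : PowerSeries.constantCoeff k ≠ 0) (hμ : μ ≠ 0)
    (hh₀ : PowerSeries.constantCoeff h ≠ 0) (hh : h = μ • PowerSeries.derivative ℝ k⁻¹) (n : ℕ) :
    (volterraP k h ^ n) 1 = μ ^ n • (((PowerSeries.constantCoeff k)⁻¹ • k) *
      (expFrom n).subst
        (PowerSeries.logOf (PowerSeries.C (PowerSeries.constantCoeff k) * k⁻¹))) := by
  have H := isVolterraPair_volterra hk₀ hμ hh₀ hh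
  set a := PowerSeries.constantCoeff k with ha
  set v := PowerSeries.C a * k⁻¹ with hv
  have hv1 : PowerSeries.constantCoeff v = 1 := by
    rw [hv, map_mul, PowerSeries.constantCoeff_inv, PowerSeries.constantCoeff_C, ← ha,
      mul_inv_cancel₀ hk₀]
  have hL := PowerSeries.constantCoeff_logOf hv1
  have hk : k⁻¹ * k = 1 := PowerSeries.inv_mul_cancel k hk₀
  have hhi : h⁻¹ * h = 1 := PowerSeries.inv_mul_cancel h hh₀
  have haa : PowerSeries.C a * PowerSeries.C a⁻¹ = (1 : ℝ⟦X⟧) := by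
    rw [← map_mul, mul_inv_cancel₀ hk₀, map_one]
  have hdv : PowerSeries.C μ * PowerSeries.derivative ℝ v = PowerSeries.C a * h := by
    rw [hv, hh, Derivation.leibniz, PowerSeries.derivative_C, PowerSeries.smul_eq_C_mul]
    simp only [smul_eq_mul, mul_zero, add_zero]
    ring
  -- From `v L' = v'` and `μ v' = k(0) h`, with `v = k(0)/k`.
  have hdL : PowerSeries.C μ * PowerSeries.derivative ℝ (PowerSeries.logOf v) = k * h := by
    have h1 := mul_derivative_logOf hv1
    rw [hv] at h1 hdv ⊢
    set L' := PowerSeries.derivative ℝ (PowerSeries.logOf (PowerSeries.C a * k⁻¹))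
    linear_combination (k * PowerSeries.C a⁻¹) * hdv
      + (k * PowerSeries.C a⁻¹ * PowerSeries.C μ) * h1 + (k * h) * haa
      - (PowerSeries.C μ * L') * hk - (PowerSeries.C μ * L' * k⁻¹ * k) * haa
  induction n with
  | zero =>
    rw [subst_logOf_expFrom_zero hv1, pow_zero, pow_zero, one_smul, Module.End.one_apply,
      PowerSeries.smul_eq_C_mul, hv]
    linear_combination -hk - (k * k⁻¹) * haa
  | succ n ih =>
    rw [pow_succ', Module.End.mul_apply, ih]
    set f := μ ^ (n + 1) • ((a⁻¹ • k) * (expFrom (n + 1)).subst (PowerSeries.logOf v)) with hf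
    have hf0 : PowerSeries.constantCoeff f = 0 := by
      rw [hf, PowerSeries.smul_eq_C_mul, map_mul, map_mul, constantCoeff_subst_expFrom hL,
        constantCoeff_expFrom_succ, mul_zero, mul_zero]
    -- The exponential tail from `n + 1` has no constant term, so it suffices that `D_K` sends the
    -- new formula to the previous one.
    rw [← H.P_D f hf0]
    congr 1
    have e : k⁻¹ * f = PowerSeries.C (μ ^ (n + 1) * a⁻¹) *
        (expFrom (n + 1)).subst (PowerSeries.logOf v) := by
      rw [hf, PowerSeries.smul_eq_C_mul, PowerSeries.smul_eq_C_mul, map_mul]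
      linear_combination (PowerSeries.C (μ ^ (n + 1)) * PowerSeries.C a⁻¹ *
        (expFrom (n + 1)).subst (PowerSeries.logOf v)) * hk
    rw [volterraD_apply, e, Derivation.leibniz, PowerSeries.derivative_C, smul_zero, add_zero,
      PowerSeries.derivative_subst (PowerSeries.HasSubst.of_constantCoeff_zero' hL),
      derivative_expFrom_succ, PowerSeries.smul_eq_C_mul, PowerSeries.smul_eq_C_mul, smul_eq_mul,
      pow_succ, map_mul, map_mul]
    set E := (expFrom n).subst (PowerSeries.logOf v)
    linear_combination (-(h⁻¹ * PowerSeries.C (μ ^ n) * PowerSeries.C a⁻¹ * E)) * hdL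
      - (PowerSeries.C (μ ^ n) * PowerSeries.C a⁻¹ * E * k) * hhi

theorem mainTheorem5 (k h : ℝ⟦X⟧) (μ : ℝ)
    (hk₀ : PowerSeries.constantCoeff k ≠ 0) (hk₁ : PowerSeries.coeff 1 k ≠ 0) (hμ : μ ≠ 0)
    (hh : h = μ • PowerSeries.derivative ℝ k⁻¹) :
    PowerSeries.constantCoeff h ≠ 0 ∧
    IsCCMDRA (μ⁻¹ • (LinearMap.id : ℝ →ₗ[ℝ] ℝ)) xAdic (volterraD k h) (volterraP k h) ∧
    IsFreeCCMDRA.{u} (μ⁻¹ • (LinearMap.id : ℝ →ₗ[ℝ] ℝ)) xAdic (volterraD k h) (volterraP k h) ∧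
    (∃ φ : Shai ℝ ℝ ≃ₗ[ℝ] ℝ⟦X⟧,
      Shai.IsIso (μ⁻¹ • (LinearMap.id : ℝ →ₗ[ℝ] ℝ)) xAdic (volterraD k h) (volterraP k h) φ ∧
      ∀ n : ℕ, φ (Shai.pure fun _ : Fin (n + 1) => (1 : ℝ)) = (volterraP k h ^ n) 1) ∧
    ∀ n : ℕ, ∃ S : ℝ⟦X⟧,
      @HasSum ℝ⟦X⟧ (Set.Ici n) _ (filtrationTopology xAdic)
        (fun s => ((s : ℕ).factorial : ℝ)⁻¹ •
          PowerSeries.logOf (PowerSeries.C (PowerSeries.constantCoeff k) * k⁻¹) ^ (s : ℕ)) S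
        (SummationFilter.unconditional _) ∧
      (volterraP k h ^ n) 1
        = μ ^ n • (((PowerSeries.constantCoeff k)⁻¹ • k) * S) := by
  have hh₀ : PowerSeries.constantCoeff h ≠ 0 := by
    rw [hh, PowerSeries.smul_eq_C_mul, map_mul, PowerSeries.constantCoeff_C]
    exact mul_ne_zero hμ (constantCoeff_derivative_inv_ne_zero hk₀ hk₁)
  have H := isVolterraPair_volterra hk₀ hμ hh₀ hh
  refine ⟨hh₀, H.isCCMDRA, H.isFreeCCMDRA, ⟨H.shaiEquiv, H.isIso_shaiEquiv, H.shaiEquiv_pure_one⟩,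
    fun n => ⟨_, hasSum_subst_expFrom (PowerSeries.constantCoeff_logOf ?_) n,
      volterraP_pow_one hk₀ hμ hh₀ hh n⟩⟩
  rw [map_mul, PowerSeries.constantCoeff_inv, PowerSeries.constantCoeff_C, mul_inv_cancel₀ hk₀]
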